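/- Let $K$ be a field and $R=K[x_1,\dots,x_n]$, multigraded by $\mathbb Z^n$ with $\operatorname{mdeg}(x_j)$ the $j$-th standard basis vector. For $F\subseteq[n]=\{1,\dots,n\}$ put $\mathbf x_F=\prod_{i\in F}x_i$. A $d$-uniform clutter $\mathcal C$ on $[n]$ is a set of $d$-subsets of $[n]$ (its circuits); its circuit ideal is $I(\mathcal C)=(\mathbf x_F : F\in\mathcal C)\subseteq R$, and $\overline{\mathcal C}$ is the $d$-uniform clutter of all $d$-subsets of $[n]$ not in $\mathcal C$. A $(d-1)$-subset $e$ of $[n]$ is a simplicial maximal subcircuit of $\mathcal C$ if its closed neighborhood $N_{\mathcal C}[e]=e\cup\{i\in[n] : e\cup\{i\}\in\mathcal C\}$ has at least $d$ elements and every $d$-subset of $N_{\mathcal C}[e]$ is a circuit of $\mathcal C$. For a monomial ideal $I$, the multigraded Betti number $\beta_{i,\mathbf a}(I)$ is the number of summands $R[-\mathbf a]$ in homological degree $i$ of the minimal multigraded free resolution of $I$, and $\beta_{i,j}(I)=\sum_{\mathbf a\in\mathbb Z^n,\ |\mathbf a|=j}\beta_{i,\mathbf a}(I)$, where $|\mathbf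 a|=a_1+\dots+a_n$. For a set $B$, $\binom{B}{k}$ denotes the collection of $k$-subsets of $B$, and $\operatorname{supp}(\mathbf a)=\{j : a_j\neq 0\}$. **Corollary.** Let $\mathcal C$ be a $d$-uniform clutter on $[n]$, let $e$ be a simplicial maximal subcircuit of $\mathcal C$, and let $A$ be a non-empty subset of $\{F\in\mathcal C : e\subsetneq F\}$. Let $\mathcal D=\mathcal C\setminus A$, $I=I(\overline{\mathcal C})$ and $J=I(\overline{\mathcal D})$. Put $X=\{i\in[n] : x_i\mathbf x_e=\mathbf x_F \text{ for some } F\in A\}$ and $Y=\{i\in[n] : x_i\in I:\mathbf x_e\}$. Then $J=I+(\mathbf x_F : F\in A)$, and: 1. For all $i\ge 0$ and $\mathbf a\in\mathbb Z^n$, $$\beta_{i,\mathbf a}(J)=\beta_{i,\mathbf a}(I)+\begin{cases}1,&\text{if }\mathbf a\text{ satisfies }(\clubsuit),\\0,&\text{otherwise,}\end{cases}$$ where $(\clubsuit)$ means that $|\mathbf a|=d+i$, $\mathbf a-\operatorname{mdeg}(\mathbf x_e)\in\{0,1\}^n$ and $\operatorname{supp}(\mathbf a-\operatorname{mdeg}(\mathbf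 x_e))\in\binom{X\cup Y}{i+1}\setminus\binom{Y}{i+1}$. 2. For all $i\ge 0$, $$\beta_{i,d+i}(J)=\beta_{i,d+i}(I)+\binom{r_1}{i+1}-\binom{r_2}{i+1},\qquad r_1=|X\cup Y|,\ r_2=|Y|.$$ -/

import Mathlib

/-- A multihomogeneous polynomial of multidegree `a ∈ ℤⁿ`, where `mdeg (x_j)` is the `j`-th standard
basis vector of `ℤⁿ`. -/
def IsMultihomogeneous {n : ℕ} {K : Type*} [Field K] (f : MvPolynomial (Fin n) K)
    (a : Fin n → ℤ) : Prop :=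
  MvPolynomial.IsWeightedHomogeneous (fun j : Fin n => (Pi.single j 1 : Fin n → ℤ)) f a

/-- A minimal multigraded free resolution
`⋯ → F₁ → F₀ → I → 0` of an ideal `I` of `R = K[x_1, …, x_n]`.
Here `F i = ⨁_b R[-deg i b]`, `b` running through `Fin (rank i)`, so that the `b`-th basis vector of
`F i` has multidegree `deg i b`. All maps preserve multidegrees, and minimality says that the image
of `F (i+1)` lies in `𝔪 F i`, where `𝔪 = (x_1, …, x_n)`. (Minimal resolutions are automatically of
finite length, so this is not asked for separately.) -/
structure MinimalMultigradedFreeResolution {n : ℕ} {K : Type*} [Field K]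
    (I : Ideal (MvPolynomial (Fin n) K)) where
  /-- the rank of `F i` -/
  rank : ℕ → ℕ
  /-- the multidegrees of the basis vectors of `F i` -/
  deg : (i : ℕ) → Fin (rank i) → (Fin n → ℤ)
  /-- the augmentation `F 0 → I ⊆ R` -/
  aug : (Fin (rank 0) → MvPolynomial (Fin n) K) →ₗ[MvPolynomial (Fin n) K] MvPolynomial (Fin n) K
  /-- the differential `F (i+1) → F i` -/
  d : (i : ℕ) → (Fin (rank (i + 1)) → MvPolynomial (Fin n) K) →ₗ[MvPolynomial (Fin n) K]
    (Fin (rank i) → MvPolynomial (Fin n) K)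
  aug_homogeneous : ∀ b, IsMultihomogeneous (aug (Pi.single b 1)) (deg 0 b)
  d_homogeneous : ∀ i b c,
    IsMultihomogeneous (d i (Pi.single b 1) c) (deg (i + 1) b - deg i c)
  range_aug : LinearMap.range aug = I
  exact_zero : LinearMap.range (d 0) = LinearMap.ker aug
  exact_succ : ∀ i, LinearMap.range (d (i + 1)) = LinearMap.ker (d i)
  minimal : ∀ i v c, d i v c ∈ Ideal.span (Set.range (MvPolynomial.X (R := K) (σ := Fin n)))

/-- The number of summands `R[-a]` of the `i`-th module of a minimal multigraded free resolution. -/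
def MinimalMultigradedFreeResolution.multiplicity {n : ℕ} {K : Type*} [Field K]
    {I : Ideal (MvPolynomial (Fin n) K)} (F : MinimalMultigradedFreeResolution I)
    (i : ℕ) (a : Fin n → ℤ) : ℕ :=
  (Finset.univ.filter (fun b => F.deg i b = a)).card

/-! ### Existence of minimal multigraded free resolutions -/

/-- A submodule of `⨁_c R[-deg c]` that is generated by multihomogeneous elements. -/
def IsMultigradedSubmodule {n : ℕ} {K : Type*} [Field K] {r : ℕ} (deg : Fin r → (Fin n → ℤ))
    (N : Submodule (MvPolynomial (Fin n) K) (Fin r → MvPolynomial (Fin n) K)) : Prop :=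
  N ≤ Submodule.span _ {v | v ∈ N ∧ ∃ a : Fin n → ℤ, ∀ c, IsMultihomogeneous (v c) (a - deg c)}

theorem component_mul {n : ℕ} {K : Type*} [Field K] (f g : MvPolynomial (Fin n) K)
    (a b : Fin n → ℤ) (hg : IsMultihomogeneous g b) :
    MvPolynomial.weightedHomogeneousComponent
      (fun j : Fin n => (Pi.single j 1 : Fin n → ℤ)) (a + b) (f * g) =
    MvPolynomial.weightedHomogeneousComponent
      (fun j : Fin n => (Pi.single j 1 : Fin n → ℤ)) a f * g := by
  classical
  let _ := MvPolynomial.weightedGradedAlgebra K (fun j : Fin n => (Pi.single j 1 : Fin n → ℤ))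
  have := DirectSum.coe_decompose_mul_add_of_right_mem
    (MvPolynomial.weightedHomogeneousSubmodule K (fun j : Fin n => (Pi.single j 1 : Fin n → ℤ)))
    (a := f) (b := g) (i := a) (j := b) hg
  have h2 : ∀ (φ : MvPolynomial (Fin n) K) (m : Fin n → ℤ),
      (DirectSum.decompose (MvPolynomial.weightedHomogeneousSubmodule K
        (fun j : Fin n => (Pi.single j 1 : Fin n → ℤ))) φ m : MvPolynomial (Fin n) K) =
      MvPolynomial.weightedHomogeneousComponent
        (fun j : Fin n => (Pi.single j 1 : Fin n → ℤ)) m φ :=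
    fun φ m => MvPolynomial.weightedDecomposition.decompose'_apply K _ φ m
  rw [h2, h2] at this
  exact this

theorem isMultigradedSubmodule_ker {n : ℕ} {K : Type*} [Field K] {r s : ℕ}
    (deg : Fin r → (Fin n → ℤ)) (δ : Fin s → (Fin n → ℤ))
    (g : Fin s → Fin r → MvPolynomial (Fin n) K)
    (hg : ∀ b c, IsMultihomogeneous (g b c) (δ b - deg c)) :
    IsMultigradedSubmodule δ (LinearMap.ker (Fintype.linearCombination
      (MvPolynomial (Fin n) K) g)) := by
  classical
  intro v hv
  set w := (fun j : Fin n => (Pi.single j 1 : Fin n → ℤ)) with hw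
  -- the components of a kernel element lie in the kernel
  have hcomp : ∀ a : Fin n → ℤ, (fun b => MvPolynomial.weightedHomogeneousComponent w
      (a - δ b) (v b)) ∈ LinearMap.ker (Fintype.linearCombination (MvPolynomial (Fin n) K) g) := by
    intro a
    rw [LinearMap.mem_ker, Fintype.linearCombination_apply] at hv ⊢
    funext c
    have h1 := congrFun hv c
    simp only [Finset.sum_apply, Pi.smul_apply, smul_eq_mul, Pi.zero_apply] at h1 ⊢
    have h2 := congrArg (MvPolynomial.weightedHomogeneousComponent w (a - deg c)) h1
    rw [map_sum, map_zero] at h2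
    rw [← h2]
    refine Finset.sum_congr rfl fun b _ => ?_
    rw [← component_mul (v b) (g b c) (a - δ b) (δ b - deg c) (hg b c)]
    have h3 : a - deg c = a - δ b + (δ b - deg c) := by abel
    rw [h3]
  -- a finite set of degrees that suffices
  set T : Finset (Fin n → ℤ) := Finset.univ.biUnion
    (fun b => (v b).support.image (fun m => Finsupp.weight w m + δ b)) with hT
  have hsum : v = ∑ a ∈ T, (fun b => MvPolynomial.weightedHomogeneousComponent w
      (a - δ b) (v b)) := by
    funext b
    rw [Finset.sum_apply]
    ext m
    rw [MvPolynomial.coeff_sum]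
    simp only [MvPolynomial.coeff_weightedHomogeneousComponent]
    have : ∀ a : Fin n → ℤ, (Finsupp.weight w m = a - δ b) ↔ (a = Finsupp.weight w m + δ b) := by
      intro a
      constructor
      · intro h; rw [h]; abel
      · intro h; rw [h]; abel
    simp only [this, Finset.sum_ite_eq']
    split_ifs with h
    · rfl
    · by_contra h0
      apply h
      rw [hT, Finset.mem_biUnion]
      exact ⟨b, Finset.mem_univ _, Finset.mem_image.mpr ⟨m, MvPolynomial.mem_support_iff.mpr h0, rfl⟩⟩
  rw [hsum]
  refine Submodule.sum_mem _ fun a _ => Submodule.subset_span ⟨hcomp a, a, fun b => ?_⟩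
  exact MvPolynomial.weightedHomogeneousComponent_isWeightedHomogeneous _ _

theorem exists_minimal_cover {n : ℕ} {K : Type*} [Field K] {r : ℕ} (deg : Fin r → (Fin n → ℤ))
    (N : Submodule (MvPolynomial (Fin n) K) (Fin r → MvPolynomial (Fin n) K))
    (hN : IsMultigradedSubmodule deg N) :
    ∃ (s : ℕ) (δ : Fin s → (Fin n → ℤ)) (g : Fin s → Fin r → MvPolynomial (Fin n) K),
      (∀ b c, IsMultihomogeneous (g b c) (δ b - deg c)) ∧
      Submodule.span (MvPolynomial (Fin n) K) (Set.range g) = N ∧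
      ∀ v ∈ LinearMap.ker (Fintype.linearCombination (MvPolynomial (Fin n) K) g),
        ∀ b, MvPolynomial.constantCoeff (v b) = 0 := by
  classical
  set P : ℕ → Prop := fun s => ∃ (δ : Fin s → (Fin n → ℤ))
    (g : Fin s → Fin r → MvPolynomial (Fin n) K),
      (∀ b c, IsMultihomogeneous (g b c) (δ b - deg c)) ∧
      Submodule.span (MvPolynomial (Fin n) K) (Set.range g) = N with hP
  -- a multihomogeneous generating family on a finite type gives one on `Fin s`
  have key : ∀ (κ : Type) [Fintype κ] (δ : κ → (Fin n → ℤ))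
      (g : κ → Fin r → MvPolynomial (Fin n) K),
      (∀ b c, IsMultihomogeneous (g b c) (δ b - deg c)) →
      Submodule.span (MvPolynomial (Fin n) K) (Set.range g) = N → P (Fintype.card κ) := by
    intro κ _ δ g h1 h2
    refine ⟨δ ∘ (Fintype.equivFin κ).symm, g ∘ (Fintype.equivFin κ).symm, fun b c => h1 _ c, ?_⟩
    rw [(Fintype.equivFin κ).symm.surjective.range_comp]
    exact h2
  have hex : ∃ s, P s := by
    set S := {v | v ∈ N ∧ ∃ a : Fin n → ℤ, ∀ c, IsMultihomogeneous (v c) (a - deg c)} with hS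
    have hspan : Submodule.span (MvPolynomial (Fin n) K) S = N :=
      le_antisymm (Submodule.span_le.mpr fun v hv => hv.1) hN
    obtain ⟨t, ht, hts⟩ := (Submodule.fg_span_iff_fg_span_finset_subset S).mp
      (IsNoetherian.noetherian (Submodule.span (MvPolynomial (Fin n) K) S))
    choose a ha using fun v : t => (ht v.2).2
    refine ⟨t.card, a ∘ t.equivFin.symm, fun b => (t.equivFin.symm b : Fin r → _),
      fun b c => ha _ c, ?_⟩
    rw [← hspan, hts]
    congr 1
    ext v
    constructor
    · rintro ⟨b, rfl⟩
      exact (t.equivFin.symm b).2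
    · intro hv
      exact ⟨t.equivFin ⟨v, hv⟩, by simp⟩
  obtain ⟨δ, g, hg, hspan⟩ := Nat.find_spec hex
  refine ⟨Nat.find hex, δ, g, hg, hspan, ?_⟩
  -- homogeneous relations have no constant coefficients
  have hhom : ∀ v ∈ {v | v ∈ LinearMap.ker (Fintype.linearCombination (MvPolynomial (Fin n) K) g)
      ∧ ∃ a : Fin n → ℤ, ∀ c, IsMultihomogeneous (v c) (a - δ c)},
      ∀ b, MvPolynomial.constantCoeff (v b) = 0 := by
    rintro v ⟨hv, a, ha⟩ b
    by_contra hb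
    have hab : a - δ b = 0 := by
      have := ha b (d := 0) (by simpa [MvPolynomial.constantCoeff_eq] using hb)
      simpa using this.symm
    have hC : v b = MvPolynomial.C (MvPolynomial.constantCoeff (v b)) := by
      ext m
      rw [MvPolynomial.coeff_C]
      split_ifs with h
      · rw [← h, MvPolynomial.constantCoeff_eq]
      · by_contra hm
        have h1 := ha b hm
        rw [hab] at h1
        apply h
        ext j
        have h2 := congrFun h1 j
        simp only [Finsupp.weight_apply, Finsupp.sum, Finset.sum_apply, Pi.smul_apply,
          Pi.zero_apply, Pi.single_apply] at h2
        simp at h2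
        simp [h2]
    have hmem : g b ∈ Submodule.span (MvPolynomial (Fin n) K)
        (Set.range (fun k : {k // k ≠ b} => g k)) := by
      rw [LinearMap.mem_ker, Fintype.linearCombination_apply,
        ← Finset.add_sum_erase _ _ (Finset.mem_univ b)] at hv
      have h3 : v b • g b ∈ Submodule.span (MvPolynomial (Fin n) K)
          (Set.range (fun k : {k // k ≠ b} => g k)) := by
        rw [eq_neg_of_add_eq_zero_left hv]
        refine Submodule.neg_mem _ (Submodule.sum_mem _ fun k hk => Submodule.smul_mem _ _
          (Submodule.subset_span ⟨⟨k, (Finset.mem_erase.mp hk).1⟩, rfl⟩))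
      have h4 := Submodule.smul_mem _
        (MvPolynomial.C (MvPolynomial.constantCoeff (v b))⁻¹ : MvPolynomial (Fin n) K) h3
      rw [smul_smul, hC, MvPolynomial.constantCoeff_C, ← MvPolynomial.C_mul, inv_mul_cancel₀ hb,
        MvPolynomial.C_1, one_smul] at h4
      exact h4
    have hP' : P (Fintype.card {k // k ≠ b}) := by
      refine key {k // k ≠ b} (fun k => δ k) (fun k => g k) (fun k c => hg k c) ?_
      rw [← hspan]
      refine le_antisymm (Submodule.span_mono ?_) (Submodule.span_le.mpr ?_)
      · rintro _ ⟨k, rfl⟩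
        exact ⟨k, rfl⟩
      · rintro _ ⟨k, rfl⟩
        by_cases hk : k = b
        · rw [hk]; exact hmem
        · exact Submodule.subset_span ⟨⟨k, hk⟩, rfl⟩
    have hlt : Fintype.card {k // k ≠ b} < Nat.find hex := by
      have := Fintype.card_subtype_lt (p := fun k => k ≠ b) (x := b) (by simp)
      simpa using this
    exact Nat.find_min hex hlt hP'
  intro v hv
  have := isMultigradedSubmodule_ker deg δ g hg hv
  refine Submodule.span_induction (p := fun v _ => ∀ b, MvPolynomial.constantCoeff (v b) = 0)
    hhom ?_ ?_ ?_ this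
  · intro b; simp
  · intro x y _ _ hx hy b
    rw [Pi.add_apply, map_add, hx b, hy b, add_zero]
  · intro f x _ hx b
    rw [Pi.smul_apply, smul_eq_mul, map_mul, hx b, mul_zero]

/-- A step in the construction of a resolution: a multigraded submodule `N` of a multigraded free
module; `next` replaces it by the syzygies of a minimal multihomogeneous generating family. -/
structure SyzygyStage (n : ℕ) (K : Type*) [Field K] where
  r : ℕ
  deg : Fin r → (Fin n → ℤ)
  N : Submodule (MvPolynomial (Fin n) K) (Fin r → MvPolynomial (Fin n) K)
  graded : IsMultigradedSubmodule deg N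

noncomputable def SyzygyStage.gens {n : ℕ} {K : Type*} [Field K] (S : SyzygyStage n K) :
    Fin (exists_minimal_cover S.deg S.N S.graded).choose → Fin S.r → MvPolynomial (Fin n) K :=
  (exists_minimal_cover S.deg S.N S.graded).choose_spec.choose_spec.choose

noncomputable def SyzygyStage.next {n : ℕ} {K : Type*} [Field K] (S : SyzygyStage n K) :
    SyzygyStage n K where
  r := (exists_minimal_cover S.deg S.N S.graded).choose
  deg := (exists_minimal_cover S.deg S.N S.graded).choose_spec.choose
  N := LinearMap.ker (Fintype.linearCombination (MvPolynomial (Fin n) K) S.gens)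
  graded := isMultigradedSubmodule_ker S.deg _ S.gens
    (exists_minimal_cover S.deg S.N S.graded).choose_spec.choose_spec.choose_spec.1

noncomputable def SyzygyStage.map {n : ℕ} {K : Type*} [Field K] (S : SyzygyStage n K) :
    (Fin S.next.r → MvPolynomial (Fin n) K) →ₗ[MvPolynomial (Fin n) K]
      (Fin S.r → MvPolynomial (Fin n) K) :=
  Fintype.linearCombination (MvPolynomial (Fin n) K) S.gens

theorem SyzygyStage.map_homogeneous {n : ℕ} {K : Type*} [Field K] (S : SyzygyStage n K)
    (b : Fin S.next.r) (c : Fin S.r) :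
    IsMultihomogeneous (S.map (Pi.single b 1) c) (S.next.deg b - S.deg c) := by
  have h := (exists_minimal_cover S.deg S.N S.graded).choose_spec.choose_spec.choose_spec.1 b c
  have : S.map (Pi.single b 1) = S.gens b := by
    unfold SyzygyStage.map
    exact (Fintype.linearCombination_apply_single _ _ _ _).trans (one_smul _ _)
  rw [this]
  exact h

theorem SyzygyStage.range_map {n : ℕ} {K : Type*} [Field K] (S : SyzygyStage n K) :
    LinearMap.range S.map = S.N := by
  have h := (exists_minimal_cover S.deg S.N S.graded).choose_spec.choose_spec.choose_spec.2.1
  exact (Fintype.range_linearCombination _ _).trans h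

theorem SyzygyStage.mem_maximal {n : ℕ} {K : Type*} [Field K] (S : SyzygyStage n K)
    (v : Fin S.next.r → MvPolynomial (Fin n) K) (hv : v ∈ S.next.N) (b : Fin S.next.r) :
    v b ∈ Ideal.span (Set.range (MvPolynomial.X (R := K) (σ := Fin n))) := by
  have h := (exists_minimal_cover S.deg S.N S.graded).choose_spec.choose_spec.choose_spec.2.2 v hv b
  rw [← Set.image_univ, MvPolynomial.mem_ideal_span_X_image]
  intro m hm
  by_contra hcon
  push Not at hcon
  have hm0 : m = 0 := by
    ext j
    exact hcon j (Set.mem_univ j)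
  rw [hm0, MvPolynomial.mem_support_iff] at hm
  exact hm h

noncomputable def SyzygyStage.iter {n : ℕ} {K : Type*} [Field K] (S : SyzygyStage n K) :
    ℕ → SyzygyStage n K
  | 0 => S
  | i + 1 => (SyzygyStage.iter S i).next

/-- An ideal generated by monomials. -/
def IsMonomialIdeal {n : ℕ} {K : Type*} [Field K] (I : Ideal (MvPolynomial (Fin n) K)) : Prop :=
  ∃ M : Set (Fin n →₀ ℕ), I = Ideal.span ((fun m => MvPolynomial.monomial m (1 : K)) '' M)

theorem IsMonomialIdeal.nonempty_resolution {n : ℕ} {K : Type*} [Field K]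
    {I : Ideal (MvPolynomial (Fin n) K)} (hI : IsMonomialIdeal I) :
    Nonempty (MinimalMultigradedFreeResolution I) := by
  classical
  obtain ⟨M, rfl⟩ := hI
  set I := Ideal.span ((fun m => MvPolynomial.monomial m (1 : K)) '' M) with hI
  let π : (Fin 1 → MvPolynomial (Fin n) K) ≃ₗ[MvPolynomial (Fin n) K] MvPolynomial (Fin n) K :=
    LinearEquiv.funUnique (Fin 1) _ _
  let N := Submodule.span (MvPolynomial (Fin n) K)
    ((fun m => (fun _ : Fin 1 => MvPolynomial.monomial m (1 : K))) '' M)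
  have hNI : N.map π.toLinearMap = I := by
    rw [Submodule.map_span, ← Set.image_comp]
    rfl
  have hN : IsMultigradedSubmodule (fun _ => 0) N := by
    refine Submodule.span_mono ?_
    rintro _ ⟨m, hm, rfl⟩
    refine ⟨Submodule.subset_span ⟨m, hm, rfl⟩, _, fun c =>
      MvPolynomial.isWeightedHomogeneous_monomial _ m 1 (sub_zero _).symm⟩
  let S : SyzygyStage n K := ⟨1, fun _ => 0, N, hN⟩
  refine ⟨{
    rank := fun i => (S.iter (i + 1)).r
    deg := fun i => (S.iter (i + 1)).deg
    aug := π.toLinearMap ∘ₗ S.map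
    d := fun i => (S.iter (i + 1)).map
    aug_homogeneous := ?_
    d_homogeneous := fun i b c => (S.iter (i + 1)).map_homogeneous b c
    range_aug := ?_
    exact_zero := ?_
    exact_succ := fun i => (S.iter (i + 2)).range_map
    minimal := ?_ }⟩
  · intro b
    have h := S.map_homogeneous b 0
    have h0 : S.next.deg b - S.deg 0 = S.next.deg b := sub_zero _
    rw [h0] at h
    exact h
  · exact ((LinearMap.range_comp S.map π.toLinearMap).trans
      (congrArg (Submodule.map π.toLinearMap) S.range_map)).trans hNI
  · exact (S.iter 1).range_map.trans (LinearEquiv.ker_comp π S.map).symm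
  · intro i v c
    refine (S.iter i).mem_maximal _ ?_ c
    have h : (S.iter (i + 1)).map v ∈ LinearMap.range (S.iter (i + 1)).map := ⟨v, rfl⟩
    rw [(S.iter (i + 1)).range_map] at h
    exact h

/-! ### Betti numbers -/

open Classical in
/-- The multigraded Betti number `β_{i,a}(I)`: the number of summands `R[-a]` of the `i`-th module
of the minimal multigraded free resolution of `I`. The resolution exists for every monomial ideal by
`IsMonomialIdeal.nonempty_resolution`, and it is unique up to isomorphism; for ideals
that are not multigraded the value is `0` by convention. -/
noncomputable def multigradedBetti {n : ℕ} {K : Type*} [Field K]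
    (I : Ideal (MvPolynomial (Fin n) K)) (i : ℕ) (a : Fin n → ℤ) : ℕ :=
  if h : Nonempty (MinimalMultigradedFreeResolution I) then h.some.multiplicity i a else 0

/-- The graded Betti number `β_{i,j}(I) = ∑_{a ∈ ℤⁿ, |a| = j} β_{i,a}(I)`
(only finitely many summands are nonzero). -/
noncomputable def gradedBetti {n : ℕ} {K : Type*} [Field K]
    (I : Ideal (MvPolynomial (Fin n) K)) (i : ℕ) (j : ℤ) : ℕ :=
  ∑ᶠ (a : Fin n → ℤ) (_ : ∑ k, a k = j), multigradedBetti I i a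

/-! ### Clutters -/

/-- A `d`-uniform clutter on `[n]`, given by its set of circuits. -/
structure IsUniformClutter {n : ℕ} (d : ℕ) (C : Finset (Finset (Fin n))) : Prop where
  antichain : ∀ F ∈ C, ∀ G ∈ C, F ≠ G → ¬ F ⊆ G
  card_eq : ∀ F ∈ C, F.card = d

/-- The complement of a `d`-uniform clutter: all `d`-subsets of `[n]` that are not circuits. -/
def complementClutter {n : ℕ} (d : ℕ) (C : Finset (Finset (Fin n))) : Finset (Finset (Fin n)) :=
  Finset.powersetCard d Finset.univ \ C

/-- The squarefree monomial `x_F = ∏_{i ∈ F} x_i`. -/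
noncomputable def squarefreeMonomial {n : ℕ} (K : Type*) [Field K] (F : Finset (Fin n)) :
    MvPolynomial (Fin n) K :=
  ∏ i ∈ F, MvPolynomial.X i

/-- The multidegree of `x_F`. -/
def squarefreeMultidegree {n : ℕ} (F : Finset (Fin n)) : Fin n → ℤ :=
  fun j => if j ∈ F then 1 else 0

/-- The circuit ideal `I(C) = (x_F : F ∈ C)`. -/
noncomputable def circuitIdeal {n : ℕ} (K : Type*) [Field K] (C : Finset (Finset (Fin n))) :
    Ideal (MvPolynomial (Fin n) K) :=
  Ideal.span {f | ∃ F ∈ C, f = squarefreeMonomial K F}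

theorem isMonomialIdeal_circuitIdeal {n : ℕ} (K : Type*) [Field K]
    (C : Finset (Finset (Fin n))) : IsMonomialIdeal (circuitIdeal K C) := by
  refine ⟨{m | ∃ F ∈ C, m = ∑ i ∈ F, Finsupp.single i 1}, ?_⟩
  have h : ∀ F : Finset (Fin n), squarefreeMonomial K F =
      MvPolynomial.monomial (∑ i ∈ F, Finsupp.single i 1) (1 : K) := by
    intro F
    rw [MvPolynomial.monomial_sum_one]
    rfl
  unfold circuitIdeal
  congr 1
  ext f
  constructor
  · rintro ⟨F, hF, rfl⟩
    exact ⟨_, ⟨F, hF, rfl⟩, (h F).symm⟩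
  · rintro ⟨_, ⟨F, hF, rfl⟩, rfl⟩
    exact ⟨F, hF, (h F).symm⟩

/-- The closed neighborhood `N_C[e] = e ∪ {i : e ∪ {i} ∈ C}`. -/
def closedNeighborhood {n : ℕ} (C : Finset (Finset (Fin n))) (e : Finset (Fin n)) :
    Finset (Fin n) :=
  e ∪ Finset.univ.filter (fun i => e ∪ {i} ∈ C)

/-- `e ∈ Simp(C)`: the `(d-1)`-subset `e` of `[n]` is a simplicial maximal subcircuit of the
`d`-uniform clutter `C`. -/
structure IsSimplicialMaximalSubcircuit {n : ℕ} (d : ℕ) (C : Finset (Finset (Fin n)))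
    (e : Finset (Fin n)) : Prop where
  card_add_one : e.card + 1 = d
  le_card : d ≤ (closedNeighborhood C e).card
  clique : ∀ F : Finset (Fin n), F ⊆ closedNeighborhood C e → F.card = d → F ∈ C

/-- The support `{j : a_j ≠ 0}` of a vector `a ∈ ℤⁿ`. -/
def vecSupport {n : ℕ} (a : Fin n → ℤ) : Finset (Fin n) :=
  Finset.univ.filter (fun j => a j ≠ 0)

/-! ### Simplicial chains with coefficients in a multifiltered vector space -/

section Koszul

variable {n : ℕ} {K : Type*} [Field K] {E : Type*} [AddCommGroup E] [Module K E]

theorem Submodule.finrank_map_add_finrank_inf_ker {V W : Type*} [AddCommGroup V] [Module K V]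
    [AddCommGroup W] [Module K W] [FiniteDimensional K V] (f : V →ₗ[K] W) (U : Submodule K V) :
    Module.finrank K (U.map f) + Module.finrank K (U ⊓ LinearMap.ker f : Submodule K V) =
      Module.finrank K U := by
  have h := LinearMap.finrank_range_add_finrank_ker (f.domRestrict U)
  rw [LinearMap.range_domRestrict, LinearMap.ker_domRestrict] at h
  rw [← h]
  congr 1
  rw [← Submodule.finrank_map_subtype_eq, Submodule.map_comap_subtype]

/-- The sign of the vertex `j` relative to the face `S`. -/
def faceSign (K : Type*) [Field K] (j : Fin n) (S : Finset (Fin n)) : K :=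
  (-1) ^ (S.filter (· < j)).card

theorem faceSign_mul_self (j : Fin n) (S : Finset (Fin n)) :
    faceSign K j S * faceSign K j S = 1 := by
  rw [faceSign, ← mul_pow]; simp

theorem faceSign_insert (j k : Fin n) (S : Finset (Fin n)) (hj : j ∉ S) :
    faceSign K k (insert j S) = if j < k then -faceSign K k S else faceSign K k S := by
  unfold faceSign
  rw [Finset.filter_insert]
  split_ifs with h
  · rw [Finset.card_insert_of_notMem (by simp [hj]), pow_succ]; ring
  · rfl

/-- Contraction with the vertex `j`. -/
def contractVertex (j : Fin n) : (Finset (Fin n) → E) →ₗ[K] (Finset (Fin n) → E) where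
  toFun ω T := if j ∈ T then 0 else faceSign K j T • ω (insert j T)
  map_add' ω η := by
    funext T; simp only [Pi.add_apply]; split_ifs <;> simp
  map_smul' c ω := by
    funext T; simp only [Pi.smul_apply, RingHom.id_apply]; split_ifs <;> simp [smul_comm c]

theorem contractVertex_apply (j : Fin n) (ω : Finset (Fin n) → E) (T : Finset (Fin n)) :
    contractVertex (K := K) j ω T = if j ∈ T then 0 else faceSign K j T • ω (insert j T) := rfl

/-- The join with the vertex `j`. -/
def joinVertex (j : Fin n) : (Finset (Fin n) → E) →ₗ[K] (Finset (Fin n) → E) where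
  toFun ω T := if j ∈ T then faceSign K j (T.erase j) • ω (T.erase j) else 0
  map_add' ω η := by
    funext T; simp only [Pi.add_apply]; split_ifs <;> simp
  map_smul' c ω := by
    funext T; simp only [Pi.smul_apply, RingHom.id_apply]; split_ifs <;> simp [smul_comm c]

theorem joinVertex_apply (j : Fin n) (ω : Finset (Fin n) → E) (T : Finset (Fin n)) :
    joinVertex (K := K) j ω T =
      if j ∈ T then faceSign K j (T.erase j) • ω (T.erase j) else 0 := rfl

theorem faceSign_swap {j k : Fin n} (hjk : j ≠ k) {S : Finset (Fin n)} (hj : j ∉ S) (hk : k ∉ S) :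
    faceSign K j S * faceSign K k (insert j S) = -(faceSign K k S * faceSign K j (insert k S)) := by
  rw [faceSign_insert _ _ _ hj, faceSign_insert _ _ _ hk]
  rcases lt_or_gt_of_ne hjk with h | h
  · rw [if_pos h, if_neg h.not_gt]; ring
  · rw [if_pos h, if_neg h.not_gt]; ring

theorem contractVertex_self (j : Fin n) (ω : Finset (Fin n) → E) :
    contractVertex (K := K) j (contractVertex (K := K) j ω) = 0 := by
  funext T
  simp [contractVertex_apply]

theorem contractVertex_anticomm {j k : Fin n} (hjk : j ≠ k) (ω : Finset (Fin n) → E) :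
    contractVertex (K := K) j (contractVertex (K := K) k ω) =
      -contractVertex (K := K) k (contractVertex (K := K) j ω) := by
  funext T
  simp only [contractVertex_apply, Pi.neg_apply, Finset.mem_insert, hjk, hjk.symm, false_or]
  by_cases hj : j ∈ T
  · simp [hj]
  by_cases hk : k ∈ T
  · simp [hk]
  simp only [hj, hk, if_false, smul_smul]
  rw [faceSign_swap hjk hj hk, neg_smul, Finset.insert_comm]

theorem contractVertex_joinVertex_self (j : Fin n) (ω : Finset (Fin n) → E) :
    contractVertex (K := K) j (joinVertex (K := K) j ω) +
      joinVertex (K := K) j (contractVertex (K := K) j ω) = ω := by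
  funext T
  simp only [contractVertex_apply, joinVertex_apply, Pi.add_apply]
  by_cases hj : j ∈ T
  · simp [hj, smul_smul, faceSign_mul_self, Finset.insert_erase hj]
  · simp [hj, smul_smul, faceSign_mul_self, Finset.erase_insert hj]

/-- The two composites remove `k` and insert `j` in opposite orders; exactly one of the two signs
notices the other vertex, depending on which of `j`, `k` is smaller. -/
theorem contractVertex_joinVertex {j k : Fin n} (hjk : j ≠ k) (ω : Finset (Fin n) → E) :
    contractVertex (K := K) k (joinVertex (K := K) j ω) +
      joinVertex (K := K) j (contractVertex (K := K) k ω) = 0 := by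
  funext T
  simp only [contractVertex_apply, joinVertex_apply, Pi.add_apply, Pi.zero_apply,
    Finset.mem_insert, Finset.mem_erase, hjk, hjk.symm, false_or, ne_eq, not_false_eq_true,
    true_and]
  by_cases hk : k ∈ T
  · simp [hk]
  by_cases hj : j ∈ T
  · obtain ⟨S, hS, rfl⟩ : ∃ S, j ∉ S ∧ T = insert j S :=
      ⟨T.erase j, by simp, (Finset.insert_erase hj).symm⟩
    have hk' : k ∉ S := fun h => hk (Finset.mem_insert_of_mem h)
    have h1 : (insert k (insert j S)).erase j = insert k S := by
      rw [Finset.insert_comm, Finset.erase_insert]; simp [hS, hjk]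
    simp only [hk, hj, if_false, if_true, h1, Finset.erase_insert hS, smul_smul, ← add_smul]
    have h2 : faceSign K k (insert j S) * faceSign K j (insert k S) +
        faceSign K j S * faceSign K k S = 0 := by
      rw [faceSign_insert _ _ _ hS, faceSign_insert _ _ _ hk']
      rcases lt_or_gt_of_ne hjk with h | h
      · rw [if_pos h, if_neg h.not_gt]; ring
      · rw [if_pos h, if_neg h.not_gt]; ring
    rw [h2, zero_smul]
  · simp [hj]

variable (K E) in
/-- The simplicial boundary. -/
def boundary (n : ℕ) : (Finset (Fin n) → E) →ₗ[K] (Finset (Fin n) → E) :=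
  ∑ j, contractVertex j

/-- A sum of pairwise anticommuting operators of square zero has square zero. Partial sums over a
set `A` make the induction possible. -/
theorem boundary_boundary (ω : Finset (Fin n) → E) : boundary K E n (boundary K E n ω) = 0 := by
  have h : ∀ A : Finset (Fin n), (∑ j ∈ A, contractVertex (K := K) j)
      ((∑ j ∈ A, contractVertex (K := K) j) ω) = 0 := by
    intro A
    induction A using Finset.induction_on with
    | empty => simp
    | insert k A hk ih =>
      rw [Finset.sum_insert hk, LinearMap.add_apply, LinearMap.add_apply, map_add, map_add,
        contractVertex_self, zero_add, ih, add_zero, LinearMap.sum_apply, LinearMap.sum_apply,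
        map_sum, ← Finset.sum_add_distrib]
      refine Finset.sum_eq_zero fun j hj => ?_
      rw [contractVertex_anticomm (ne_of_mem_of_not_mem hj hk).symm]
      simp
  exact h _

/-- Coning with apex `j` is a contracting homotopy of the full simplex: only the contraction with
`j` itself fails to anticommute with the join. All later acyclicity arguments check that this
homotopy respects a filtration. -/
theorem boundary_joinVertex (j : Fin n) (ω : Finset (Fin n) → E) :
    boundary K E n (joinVertex (K := K) j ω) + joinVertex (K := K) j (boundary K E n ω) = ω := by
  unfold boundary
  rw [LinearMap.sum_apply, LinearMap.sum_apply, map_sum, ← Finset.sum_add_distrib,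
    Finset.sum_eq_single j]
  · exact contractVertex_joinVertex_self j ω
  · intro k _ hk
    exact contractVertex_joinVertex hk.symm ω
  · simp

theorem boundary_apply (ω : Finset (Fin n) → E) (T : Finset (Fin n)) :
    boundary K E n ω T = ∑ j, if j ∈ T then 0 else faceSign K j T • ω (insert j T) := by
  simp [boundary, LinearMap.sum_apply, Finset.sum_apply, contractVertex_apply]

theorem boundary_compLeft {E' : Type*} [AddCommGroup E'] [Module K E'] (π : E →ₗ[K] E')
    (ω : Finset (Fin n) → E) :
    boundary K E' n (π.compLeft _ ω) = π.compLeft _ (boundary K E n ω) := by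
  funext T
  simp only [boundary_apply, LinearMap.compLeft_apply, Function.comp, map_sum]
  refine Finset.sum_congr rfl fun j _ => ?_
  split_ifs <;> simp

/-! ### Multigraded strands of the Koszul complex -/

theorem squarefreeMultidegree_insert {j : Fin n} {S : Finset (Fin n)} (hj : j ∉ S) :
    squarefreeMultidegree (insert j S) = squarefreeMultidegree S + Pi.single j 1 := by
  funext k
  by_cases h : k = j
  · subst h; simp [squarefreeMultidegree, hj]
  · simp [squarefreeMultidegree, h]

theorem squarefreeMultidegree_mono {S T : Finset (Fin n)} (h : S ⊆ T) :
    squarefreeMultidegree S ≤ squarefreeMultidegree T := by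
  intro k
  simp only [squarefreeMultidegree]
  split_ifs with h1 h2 <;> first | exact absurd (h h1) h2 | simp

/-- The strand of multidegree `a` and homological degree `p` of the Koszul complex of a
multifiltered vector space. -/
def koszulChains (N : (Fin n → ℤ) → Submodule K E) (a : Fin n → ℤ) (p : ℕ) :
    Submodule K (Finset (Fin n) → E) where
  carrier := {ω | ∀ S, ω S ∈ N (a - squarefreeMultidegree S) ∧ (S.card ≠ p → ω S = 0)}
  add_mem' hω hη S := ⟨add_mem (hω S).1 (hη S).1, fun h => by
    rw [Pi.add_apply, (hω S).2 h, (hη S).2 h, add_zero]⟩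
  zero_mem' S := ⟨zero_mem _, fun _ => rfl⟩
  smul_mem' c ω hω S := ⟨Submodule.smul_mem _ c (hω S).1, fun h => by
    rw [Pi.smul_apply, (hω S).2 h, smul_zero]⟩

theorem mem_koszulChains {N : (Fin n → ℤ) → Submodule K E} {a : Fin n → ℤ} {p : ℕ}
    {ω : Finset (Fin n) → E} : ω ∈ koszulChains N a p ↔
      ∀ S, ω S ∈ N (a - squarefreeMultidegree S) ∧ (S.card ≠ p → ω S = 0) := Iff.rfl

def koszulCycles (N : (Fin n → ℤ) → Submodule K E) (a : Fin n → ℤ) (p : ℕ) :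
    Submodule K (Finset (Fin n) → E) :=
  koszulChains N a p ⊓ LinearMap.ker (boundary K E n)

/-- The index `p` is the degree in which the boundaries live, one below that of the chains they come
from. -/
def koszulBoundaries (N : (Fin n → ℤ) → Submodule K E) (a : Fin n → ℤ) (p : ℕ) :
    Submodule K (Finset (Fin n) → E) :=
  (koszulChains N a (p + 1)).map (boundary K E n)

theorem boundary_mem_koszulChains {N : (Fin n → ℤ) → Submodule K E} (hN : Monotone N)
    {a : Fin n → ℤ} {p : ℕ} {ω : Finset (Fin n) → E} (hω : ω ∈ koszulChains N a (p + 1)) :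
    boundary K E n ω ∈ koszulChains N a p := by
  intro S
  rw [boundary_apply]
  refine ⟨Submodule.sum_mem _ fun j _ => ?_, fun hS => Finset.sum_eq_zero fun j _ => ?_⟩
  · split_ifs with h
    · exact zero_mem _
    · refine Submodule.smul_mem _ _ (hN ?_ (hω _).1)
      exact sub_le_sub_left (squarefreeMultidegree_mono (Finset.subset_insert _ _)) a
  · split_ifs with h
    · rfl
    · rw [(hω _).2, smul_zero]
      rw [Finset.card_insert_of_notMem h]; omega

theorem boundary_eq_zero_of_mem_koszulChains_zero {N : (Fin n → ℤ) → Submodule K E}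
    {a : Fin n → ℤ} {ω : Finset (Fin n) → E} (hω : ω ∈ koszulChains N a 0) :
    boundary K E n ω = 0 := by
  funext S
  rw [boundary_apply]
  refine Finset.sum_eq_zero fun j _ => ?_
  split_ifs with h
  · rfl
  · rw [(hω _).2, smul_zero]
    rw [Finset.card_insert_of_notMem h]; omega

theorem koszulCycles_zero (N : (Fin n → ℤ) → Submodule K E) (a : Fin n → ℤ) :
    koszulCycles N a 0 = koszulChains N a 0 :=
  inf_eq_left.mpr fun _ h => boundary_eq_zero_of_mem_koszulChains_zero h

theorem koszulBoundaries_le_koszulCycles {N : (Fin n → ℤ) → Submodule K E} (hN : Monotone N)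
    (a : Fin n → ℤ) (p : ℕ) : koszulBoundaries N a p ≤ koszulCycles N a p := by
  rintro _ ⟨ω, hω, rfl⟩
  exact ⟨boundary_mem_koszulChains hN hω, boundary_boundary ω⟩

/-- The dimension of the Koszul homology of a multifiltered vector space. -/
noncomputable def koszulBetti (N : (Fin n → ℤ) → Submodule K E) (a : Fin n → ℤ) (p : ℕ) : ℕ :=
  Module.finrank K (koszulCycles N a p) - Module.finrank K (koszulBoundaries N a p)

/-- The truncated subtraction defining `koszulBetti` loses nothing, since boundaries are cycles; in
additive form it can be combined linearly with the rank-nullity identities. -/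
theorem koszulBetti_add [FiniteDimensional K E] {N : (Fin n → ℤ) → Submodule K E}
    (hN : Monotone N) (a : Fin n → ℤ) (p : ℕ) :
    koszulBetti N a p + Module.finrank K (koszulBoundaries N a p) =
      Module.finrank K (koszulCycles N a p) :=
  Nat.sub_add_cancel (Submodule.finrank_mono (koszulBoundaries_le_koszulCycles hN a p))

theorem finrank_koszulBoundaries_add [FiniteDimensional K E] (N : (Fin n → ℤ) → Submodule K E)
    (a : Fin n → ℤ) (p : ℕ) :
    Module.finrank K (koszulBoundaries N a p) + Module.finrank K (koszulCycles N a (p + 1)) =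
      Module.finrank K (koszulChains N a (p + 1)) :=
  Submodule.finrank_map_add_finrank_inf_ker _ _

/-! ### Free covers and dimension shifting -/

/-- The multifiltration of `Kʳ` whose `b`-th basis vector appears in multidegree `deg b`. -/
def freeFiltration (K : Type*) [Field K] {ι : Type*} (deg : ι → (Fin n → ℤ)) (c : Fin n → ℤ) :
    Submodule K (ι → K) where
  carrier := {v | ∀ b, ¬ deg b ≤ c → v b = 0}
  add_mem' hv hw b h := by rw [Pi.add_apply, hv b h, hw b h, add_zero]
  zero_mem' _ _ := rfl
  smul_mem' k v hv b h := by rw [Pi.smul_apply, hv b h, smul_zero]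

theorem freeFiltration_mono {ι : Type*} (deg : ι → (Fin n → ℤ)) :
    Monotone (freeFiltration K deg) :=
  fun _ _ hcc' _ hv b h => hv b fun h' => h (h'.trans hcc')

theorem boundary_component {ι : Type*} (ω : Finset (Fin n) → ι → K) (b : ι)
    (S : Finset (Fin n)) :
    boundary K (ι → K) n ω S b = boundary K K n (fun T => ω T b) S := by
  simp only [boundary_apply, Finset.sum_apply]
  refine Finset.sum_congr rfl fun j _ => ?_
  split_ifs <;> simp

/-- The Koszul complex of a free module is exact, except for the basis vectors of the given
multidegree. -/
theorem mem_koszulBoundaries_freeFiltration {ι : Type*} {deg : ι → (Fin n → ℤ)}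
    {a : Fin n → ℤ} {p : ℕ} {ω : Finset (Fin n) → ι → K}
    (hω : ω ∈ koszulCycles (freeFiltration K deg) a p)
    (h0 : ∀ b, deg b = a → ω ∅ b = 0) : ω ∈ koszulBoundaries (freeFiltration K deg) a p := by
  classical
  obtain ⟨hω, hd⟩ := hω
  have hj : ∀ b, ∃ η : Finset (Fin n) → K, boundary K K n η = (fun S => ω S b) ∧
      ∀ S, (¬ deg b ≤ a - squarefreeMultidegree S → η S = 0) ∧ (S.card ≠ p + 1 → η S = 0) := by
    intro b
    by_cases hb : ∃ j, deg b j < a j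
    · obtain ⟨j, hj⟩ := hb
      -- As `deg b j < a j`, the variable `x_j` can still be split off, so the cone with apex `j`
      -- stays inside the strand.
      refine ⟨joinVertex (K := K) j (fun S => ω S b), ?_, fun S => ⟨fun hS => ?_, fun hS => ?_⟩⟩
      · have h1 := boundary_joinVertex (K := K) j (fun S => ω S b)
        have h2 : boundary K K n (fun S => ω S b) = 0 := by
          funext S
          rw [← boundary_component, LinearMap.mem_ker.mp hd]; rfl
        rwa [h2, map_zero, add_zero] at h1
      · rw [joinVertex_apply]
        split_ifs with hjS
        · rw [(hω _).1 b, smul_zero]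
          intro hle
          apply hS
          intro k
          have h3 := hle k
          by_cases hk : k = j
          · subst hk
            simp only [squarefreeMultidegree, Pi.sub_apply, hjS, if_true]
            omega
          · simpa [squarefreeMultidegree, hk] using h3
        · rfl
      · rw [joinVertex_apply]
        split_ifs with hjS
        · have h4 := congrFun ((hω (S.erase j)).2 (by
            have := Finset.card_erase_add_one hjS; omega)) b
          rw [h4]; simp
        · rfl
    · push Not at hb
      -- Now `a ≤ deg b`, so only the empty face can carry this basis vector, and only when `deg b =
      -- a`; this is the case that `h0` excludes.
      have hz : ∀ S, ω S b = 0 := by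
        intro S
        by_cases hle : deg b ≤ a - squarefreeMultidegree S
        · have hS : S = ∅ := by
            refine Finset.eq_empty_of_forall_notMem fun k hk => ?_
            have h3 := hle k
            have h4 := hb k
            simp only [squarefreeMultidegree, Pi.sub_apply, hk, if_true] at h3
            omega
          subst hS
          refine h0 b (le_antisymm (fun k => ?_) hb)
          simpa [squarefreeMultidegree] using hle k
        · exact (hω S).1 b hle
      refine ⟨0, ?_, fun S => ⟨fun _ => rfl, fun _ => rfl⟩⟩
      rw [map_zero]; funext S; exact (hz S).symm
  choose η hη1 hη2 using hj
  refine ⟨fun S b => η b S, fun S => ⟨fun b => (hη2 b S).1, fun hS => ?_⟩, ?_⟩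
  · funext b; exact (hη2 b S).2 hS
  · funext S b
    rw [boundary_component]
    exact congrFun (hη1 b) S

theorem koszulChains_map {E' : Type*} [AddCommGroup E'] [Module K E'] (π : E →ₗ[K] E')
    {F : (Fin n → ℤ) → Submodule K E} {N : (Fin n → ℤ) → Submodule K E'}
    (h : ∀ c, (F c).map π = N c) (a : Fin n → ℤ) (p : ℕ) :
    (koszulChains F a p).map (π.compLeft _) = koszulChains N a p := by
  classical
  ext ω
  constructor
  · rintro ⟨η, hη, rfl⟩ S
    refine ⟨?_, fun hS => ?_⟩
    · rw [← h]; exact ⟨_, (hη S).1, rfl⟩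
    · simp [(hη S).2 hS]
  · intro hω
    have h1 : ∀ S, ∃ v ∈ F (a - squarefreeMultidegree S), π v = ω S := fun S => by
      have := (hω S).1
      rwa [← h] at this
    choose v hv hv' using h1
    refine ⟨fun S => if S.card = p then v S else 0, fun S => ⟨?_, fun hS => if_neg hS⟩, ?_⟩
    · dsimp only
      split_ifs
      · exact hv S
      · exact zero_mem _
    · funext S
      simp only [LinearMap.compLeft_apply, Function.comp]
      split_ifs with hS
      · exact hv' S
      · rw [map_zero, (hω S).2 hS]

theorem koszulChains_inf_ker {E' : Type*} [AddCommGroup E'] [Module K E'] (π : E →ₗ[K] E')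
    (F : (Fin n → ℤ) → Submodule K E) (a : Fin n → ℤ) (p : ℕ) :
    koszulChains (fun c => F c ⊓ LinearMap.ker π) a p =
      koszulChains F a p ⊓ LinearMap.ker (π.compLeft (Finset (Fin n))) := by
  ext ω
  constructor
  · intro h
    refine ⟨fun S => ⟨(h S).1.1, (h S).2⟩, ?_⟩
    funext S
    exact (h S).1.2
  · rintro ⟨h1, h2⟩ S
    exact ⟨⟨(h1 S).1, congrFun h2 S⟩, (h1 S).2⟩

theorem koszulBoundaries_map {E' : Type*} [AddCommGroup E'] [Module K E'] (π : E →ₗ[K] E')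
    {F : (Fin n → ℤ) → Submodule K E} {N : (Fin n → ℤ) → Submodule K E'}
    (h : ∀ c, (F c).map π = N c) (a : Fin n → ℤ) (p : ℕ) :
    (koszulBoundaries F a p).map (π.compLeft _) = koszulBoundaries N a p := by
  unfold koszulBoundaries
  rw [← koszulChains_map π h, ← Submodule.map_comp, ← Submodule.map_comp]
  congr 1
  exact LinearMap.ext fun ω => (boundary_compLeft π ω).symm

/-- This is the connecting isomorphism of `0 → N' → F → N → 0` for the Koszul complexes, with `N'`
the syzygies of the cover. Exactness of `F` in positive degrees gives injectivity, and minimality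
makes `H_0(N') → H_0(F)` vanish. Instead of building the map, the proof computes the dimension of
one space `Z` in two ways: through its image in `N` and through its boundary in `N'`. -/
theorem koszulBetti_succ_of_cover {E' : Type*} [AddCommGroup E'] [Module K E']
    [FiniteDimensional K E'] {ι : Type*} [Fintype ι] {deg : ι → (Fin n → ℤ)}
    (π : (ι → K) →ₗ[K] E') {N : (Fin n → ℤ) → Submodule K E'} (hN : Monotone N)
    (h : ∀ c, (freeFiltration K deg c).map π = N c)
    (hmin : ∀ c, ∀ v ∈ freeFiltration K deg c ⊓ LinearMap.ker π, ∀ b, deg b = c → v b = 0)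
    (a : Fin n → ℤ) (p : ℕ) :
    koszulBetti N a (p + 1) =
      koszulBetti (fun c => freeFiltration K deg c ⊓ LinearMap.ker π) a p := by
  set F := freeFiltration K deg with hF
  set N' : (Fin n → ℤ) → Submodule K (ι → K) := fun c => F c ⊓ LinearMap.ker π with hN'
  have hFm : Monotone F := freeFiltration_mono deg
  have hNm : Monotone N' := fun c c' hcc => inf_le_inf_right _ (hFm hcc)
  set Φ := π.compLeft (Finset (Fin n)) with hΦ
  set D := boundary K (ι → K) n with hD
  -- chains of `F` whose boundary dies in `N`
  set Z := koszulChains F a (p + 1) ⊓ LinearMap.ker (Φ ∘ₗ D) with hZ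
  have e1 : Z.map Φ = koszulCycles N a (p + 1) := by
    ext ω
    constructor
    · rintro ⟨η, ⟨h1, h2⟩, rfl⟩
      refine ⟨?_, ?_⟩
      · rw [← koszulChains_map π h]; exact ⟨η, h1, rfl⟩
      · exact (boundary_compLeft π η).trans h2
    · rintro ⟨h1, h2⟩
      rw [← koszulChains_map π h] at h1
      obtain ⟨η, h3, rfl⟩ := h1
      exact ⟨η, ⟨h3, (boundary_compLeft π η).symm.trans h2⟩, rfl⟩
  have e2 : Z ⊓ LinearMap.ker Φ = koszulChains N' a (p + 1) := by
    rw [hN', koszulChains_inf_ker]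
    ext ω
    constructor
    · rintro ⟨⟨h1, _⟩, h3⟩
      exact ⟨h1, h3⟩
    · rintro ⟨h1, h3⟩
      refine ⟨⟨h1, ?_⟩, h3⟩
      have := boundary_compLeft π ω
      rw [LinearMap.mem_ker.mp h3, map_zero] at this
      exact this.symm
  have e3 : Z.map D = koszulCycles N' a p := by
    ext ω
    constructor
    · rintro ⟨η, ⟨h1, h2⟩, rfl⟩
      refine ⟨?_, boundary_boundary η⟩
      rw [hN', koszulChains_inf_ker]
      exact ⟨boundary_mem_koszulChains hFm h1, h2⟩
    · rintro ⟨h1, h2⟩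
      -- Minimality enters here; it matters only for `p = 0`, as otherwise `ω ∅ = 0` already.
      have h0 : ∀ b, deg b = a → ω ∅ b = 0 := by
        intro b hb
        have := (h1 ∅).1
        refine hmin _ _ this b ?_
        rw [hb]; funext k; simp [squarefreeMultidegree]
      rw [hN', koszulChains_inf_ker] at h1
      obtain ⟨η, h3, rfl⟩ := mem_koszulBoundaries_freeFiltration ⟨h1.1, h2⟩ h0
      exact ⟨η, ⟨h3, h1.2⟩, rfl⟩
  have e4 : Z ⊓ LinearMap.ker D = koszulCycles F a (p + 1) := by
    ext ω
    constructor
    · rintro ⟨⟨h1, _⟩, h3⟩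
      exact ⟨h1, h3⟩
    · rintro ⟨h1, h3⟩
      refine ⟨⟨h1, ?_⟩, h3⟩
      exact (congrArg Φ h3).trans (map_zero Φ)
  have e5 : koszulBoundaries F a (p + 1) = koszulCycles F a (p + 1) := by
    refine le_antisymm (koszulBoundaries_le_koszulCycles hFm a _) fun ω hω => ?_
    refine mem_koszulBoundaries_freeFiltration hω fun b _ => ?_
    rw [(hω.1 ∅).2 (by simp)]; rfl
  have e6 : (koszulCycles F a (p + 1)).map Φ = koszulBoundaries N a (p + 1) := by
    rw [← e5]; exact koszulBoundaries_map π h a _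
  have e7 : koszulCycles F a (p + 1) ⊓ LinearMap.ker Φ = koszulCycles N' a (p + 1) := by
    unfold koszulCycles
    rw [hN', koszulChains_inf_ker, inf_right_comm]
  have r1 := Submodule.finrank_map_add_finrank_inf_ker Φ Z
  have r2 := Submodule.finrank_map_add_finrank_inf_ker D Z
  have r3 := Submodule.finrank_map_add_finrank_inf_ker Φ (koszulCycles F a (p + 1))
  have r4 := finrank_koszulBoundaries_add N' a p
  have r5 := koszulBetti_add hN a (p + 1)
  have r6 := koszulBetti_add hNm a p
  rw [e1, e2] at r1
  rw [e3, e4] at r2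
  rw [e6, e7] at r3
  omega

/-- `H_0` is the space of minimal generators in multidegree `a`. For the free module it has the
basis vectors of multidegree `a` as a basis (`ev`), and minimality makes the passage from `F` to `N`
an isomorphism on `H_0`. -/
theorem koszulBetti_zero_of_cover {E' : Type*} [AddCommGroup E'] [Module K E']
    [FiniteDimensional K E'] {ι : Type*} [Fintype ι] {deg : ι → (Fin n → ℤ)}
    (π : (ι → K) →ₗ[K] E') {N : (Fin n → ℤ) → Submodule K E'} (hN : Monotone N)
    (h : ∀ c, (freeFiltration K deg c).map π = N c)
    (hmin : ∀ c, ∀ v ∈ freeFiltration K deg c ⊓ LinearMap.ker π, ∀ b, deg b = c → v b = 0)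
    (a : Fin n → ℤ) [DecidablePred fun b => deg b = a] :
    koszulBetti N a 0 = (Finset.univ.filter (fun b => deg b = a)).card := by
  set F := freeFiltration K deg with hF
  have hFm : Monotone F := freeFiltration_mono deg
  set Φ := π.compLeft (Finset (Fin n)) with hΦ
  -- By minimality a relation of multidegree `a` has no coefficient on basis vectors of that
  -- multidegree, so it is already a boundary in `F`.
  have e1 : koszulChains F a 0 ⊓ LinearMap.ker Φ =
      koszulBoundaries F a 0 ⊓ LinearMap.ker Φ := by
    refine le_antisymm (le_inf (fun ω hω => ?_) inf_le_right) (inf_le_inf_right _ ?_)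
    · refine mem_koszulBoundaries_freeFiltration
        ⟨hω.1, boundary_eq_zero_of_mem_koszulChains_zero hω.1⟩ fun b hb => ?_
      refine hmin _ _ ⟨(hω.1 ∅).1, congrFun hω.2 ∅⟩ b ?_
      rw [hb]; funext k; simp [squarefreeMultidegree]
    · rw [← koszulCycles_zero]
      exact koszulBoundaries_le_koszulCycles hFm a 0
  -- evaluation at the basis vectors of multidegree `a`
  let ev : (Finset (Fin n) → ι → K) →ₗ[K] ({b // deg b = a} → K) :=
    LinearMap.funLeft K K Subtype.val ∘ₗ LinearMap.proj ∅
  have e2 : koszulChains F a 0 ⊓ LinearMap.ker ev = koszulBoundaries F a 0 := by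
    ext ω
    constructor
    · rintro ⟨h1, h2⟩
      exact mem_koszulBoundaries_freeFiltration
        ⟨h1, boundary_eq_zero_of_mem_koszulChains_zero h1⟩ fun b hb => congrFun h2 ⟨b, hb⟩
    · rintro ⟨η, hη, rfl⟩
      refine ⟨boundary_mem_koszulChains hFm hη, ?_⟩
      funext b
      change boundary K (ι → K) n η ∅ b = 0
      rw [boundary_apply, Finset.sum_apply]
      refine Finset.sum_eq_zero fun j _ => ?_
      rw [if_neg (Finset.notMem_empty j), Pi.smul_apply, (hη _).1 b.1, smul_zero]
      intro hle
      have := hle j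
      rw [b.2] at this
      simp [squarefreeMultidegree] at this
  have e3 : (koszulChains F a 0).map ev = ⊤ := by
    classical
    refine eq_top_iff.mpr fun v _ => ?_
    refine ⟨fun S b => if hb : S = ∅ ∧ deg b = a then v ⟨b, hb.2⟩ else 0, fun S => ⟨?_, ?_⟩, ?_⟩
    · intro b hb
      dsimp only
      rw [dif_neg]
      rintro ⟨rfl, rfl⟩
      apply hb
      intro k; simp [squarefreeMultidegree]
    · intro hS
      funext b
      dsimp only
      rw [dif_neg]
      · rfl
      · rintro ⟨rfl, -⟩
        exact hS rfl
    · funext b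
      change (if hb : (∅ : Finset (Fin n)) = ∅ ∧ deg b = a then v ⟨b, hb.2⟩ else 0) = v b
      rw [dif_pos ⟨rfl, b.2⟩]
  have r1 := Submodule.finrank_map_add_finrank_inf_ker Φ (koszulChains F a 0)
  have r2 := Submodule.finrank_map_add_finrank_inf_ker Φ (koszulBoundaries F a 0)
  have r3 := Submodule.finrank_map_add_finrank_inf_ker ev (koszulChains F a 0)
  have r4 := koszulBetti_add hN a 0
  rw [koszulChains_map π h] at r1
  rw [koszulBoundaries_map π h] at r2
  rw [koszulCycles_zero] at r4
  rw [e2, e3, finrank_top, Module.finrank_fintype_fun_eq_card, Fintype.card_subtype] at r3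
  rw [e1] at r1
  omega

end Koszul

/-! ### Enlarging an up-set of multidegrees -/

section UpSet

variable {n : ℕ} {K : Type*} [Field K] {E : Type*} [AddCommGroup E] [Module K E]

open Classical in
/-- The multifiltration of `E` that is `E` on `P` and `0` elsewhere. -/
noncomputable def indicatorFiltration (K E : Type*) [Field K] [AddCommGroup E] [Module K E]
    (P : Set (Fin n → ℤ)) (c : Fin n → ℤ) : Submodule K E :=
  if c ∈ P then ⊤ else ⊥

theorem mem_indicatorFiltration {P : Set (Fin n → ℤ)} {c : Fin n → ℤ} {v : E} :
    v ∈ indicatorFiltration K E P c ↔ (c ∉ P → v = 0) := by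
  unfold indicatorFiltration
  split_ifs with h <;> simp [h]

theorem indicatorFiltration_mono {P : Set (Fin n → ℤ)} (hP : IsUpperSet P) :
    Monotone (indicatorFiltration K E P) := by
  intro c c' hcc v hv
  rw [mem_indicatorFiltration] at hv ⊢
  exact fun h => hv fun h' => h (hP hcc h')

theorem mem_koszulChains_indicator {P : Set (Fin n → ℤ)} {a : Fin n → ℤ} {p : ℕ}
    {ω : Finset (Fin n) → E} : ω ∈ koszulChains (indicatorFiltration K E P) a p ↔
      ∀ S, (a - squarefreeMultidegree S ∉ P → ω S = 0) ∧ (S.card ≠ p → ω S = 0) := by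
  simp only [mem_koszulChains, mem_indicatorFiltration]

theorem koszulChains_indicator_mono {P P' : Set (Fin n → ℤ)} (h : P ⊆ P') (a : Fin n → ℤ)
    (p : ℕ) : koszulChains (indicatorFiltration K E P) a p ≤
      koszulChains (indicatorFiltration K E P') a p := by
  intro ω hω
  rw [mem_koszulChains_indicator] at hω ⊢
  exact fun S => ⟨fun hS => (hω S).1 fun h' => hS (h h'), (hω S).2⟩

theorem koszulBetti_congr_of_forall {N N' : (Fin n → ℤ) → Submodule K E} {a : Fin n → ℤ}
    (h : ∀ S, N (a - squarefreeMultidegree S) = N' (a - squarefreeMultidegree S)) (p : ℕ) :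
    koszulBetti N a p = koszulBetti N' a p := by
  have : ∀ q, koszulChains N a q = koszulChains N' a q := by
    intro q; ext ω; simp only [mem_koszulChains, h]
  unfold koszulBetti koszulCycles koszulBoundaries
  rw [this, this]

/-- If the faces lying in `P'` but not in `P` are closed under adding and removing `j`, then the
Koszul homologies agree. -/
theorem koszulBetti_eq_of_cone [FiniteDimensional K E] {P P' : Set (Fin n → ℤ)}
    (hP : IsUpperSet P) (hP' : IsUpperSet P') (hPP' : P ⊆ P') {a : Fin n → ℤ} (j : Fin n)
    (hj : ∀ S, j ∉ S → (a - squarefreeMultidegree S ∈ P' \ P ↔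
      a - squarefreeMultidegree (insert j S) ∈ P' \ P)) (p : ℕ) :
    koszulBetti (indicatorFiltration K E P') a p = koszulBetti (indicatorFiltration K E P) a p := by
  classical
  set N := indicatorFiltration K E P with hN
  set N' := indicatorFiltration K E P' with hN'
  have hNm : Monotone N := indicatorFiltration_mono hP
  have hNm' : Monotone N' := indicatorFiltration_mono hP'
  -- Acyclicity of the quotient complex, whose faces are those in `P' \ P`: a relative cycle is a
  -- boundary modulo chains of `N`.
  have key : ∀ q, ∀ ω ∈ koszulChains N' a q,
      (∀ T, a - squarefreeMultidegree T ∈ P' \ P → boundary K E n ω T = 0) →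
      ∃ η ∈ koszulChains N' a (q + 1), ω - boundary K E n η ∈ koszulChains N a q := by
    intro q ω hω hd
    set ρ : Finset (Fin n) → E := fun S => if a - squarefreeMultidegree S ∈ P' \ P then ω S else 0
      with hρ
    have hη : joinVertex (K := K) j ρ ∈ koszulChains N' a (q + 1) := by
      rw [mem_koszulChains_indicator] at hω ⊢
      intro S
      rw [joinVertex_apply]
      refine ⟨fun hS => ?_, fun hS => ?_⟩
      · split_ifs with hjS
        · have h1 : ¬ a - squarefreeMultidegree (S.erase j) ∈ P' \ P := by
            rw [hj _ (Finset.notMem_erase j S), Finset.insert_erase hjS]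
            exact fun h => hS h.1
          simp only [hρ, if_neg h1, smul_zero]
        · rfl
      · split_ifs with hjS
        · have h1 : ω (S.erase j) = 0 := (hω _).2 (by
            have := Finset.card_erase_add_one hjS; omega)
          simp [hρ, h1]
        · rfl
    refine ⟨_, hη, ?_⟩
    have hsub := Submodule.sub_mem _ hω (boundary_mem_koszulChains hNm' hη)
    rw [mem_koszulChains_indicator] at hsub ⊢
    refine fun S => ⟨fun hS => ?_, (hsub S).2⟩
    by_cases hS' : a - squarefreeMultidegree S ∈ P'
    swap
    · exact (hsub S).1 hS'
    have h1 := congrFun (boundary_joinVertex (K := K) j ρ) S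
    rw [Pi.add_apply] at h1
    have h2 : joinVertex (K := K) j (boundary K E n ρ) S = 0 := by
      rw [joinVertex_apply]
      split_ifs with hjS
      · have hT : a - squarefreeMultidegree (S.erase j) ∈ P' \ P := by
          rw [hj _ (Finset.notMem_erase j S), Finset.insert_erase hjS]
          exact ⟨hS', hS⟩
        -- Truncation does not affect the boundary at a relative face: a coface in `P` would force
        -- the face itself into the up-set `P`.
        have h3 : boundary K E n ρ (S.erase j) = boundary K E n ω (S.erase j) := by
          rw [boundary_apply, boundary_apply]
          refine Finset.sum_congr rfl fun k _ => ?_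
          split_ifs with hk
          · rfl
          · congr 1
            simp only [hρ]
            split_ifs with h4
            · rfl
            · symm
              rw [mem_koszulChains_indicator] at hω
              refine (hω _).1 fun h5 => h4 ⟨h5, fun h6 => hT.2 (hP ?_ h6)⟩
              exact sub_le_sub_left (squarefreeMultidegree_mono (Finset.subset_insert _ _)) a
        rw [h3, hd _ hT, smul_zero]
      · rfl
    rw [h2, add_zero] at h1
    rw [Pi.sub_apply, h1]
    simp only [hρ, if_pos (show a - squarefreeMultidegree S ∈ P' \ P from ⟨hS', hS⟩), sub_self]
  -- This is surjectivity of `H_p(N) → H_p(N')`; `hbd` below is injectivity.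
  have hcyc : koszulCycles N' a p = koszulCycles N a p ⊔ koszulBoundaries N' a p := by
    refine le_antisymm (fun ω hω => ?_) (sup_le ?_ (koszulBoundaries_le_koszulCycles hNm' a p))
    · obtain ⟨η, hη, h⟩ := key p ω hω.1 fun T _ => by rw [LinearMap.mem_ker.mp hω.2]; rfl
      refine Submodule.mem_sup.mpr ⟨ω - boundary K E n η, ⟨h, ?_⟩, boundary K E n η,
        ⟨η, hη, rfl⟩, sub_add_cancel _ _⟩
      exact LinearMap.mem_ker.mpr
        (by rw [map_sub, LinearMap.mem_ker.mp hω.2, boundary_boundary, sub_zero])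
    · exact inf_le_inf_right _ (koszulChains_indicator_mono hPP' a p)
  have hbd : koszulCycles N a p ⊓ koszulBoundaries N' a p = koszulBoundaries N a p := by
    refine le_antisymm ?_ (le_inf (koszulBoundaries_le_koszulCycles hNm a p)
      (Submodule.map_mono (koszulChains_indicator_mono hPP' a (p + 1))))
    rintro _ ⟨h1, η, hη, rfl⟩
    obtain ⟨θ, hθ, h⟩ := key (p + 1) η hη fun T hT => by
      exact (mem_koszulChains_indicator.mp h1.1 T).1 hT.2
    exact ⟨_, h, by rw [map_sub, boundary_boundary, sub_zero]⟩
  have r1 := Submodule.finrank_sup_add_finrank_inf_eq (koszulCycles N a p)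
    (koszulBoundaries N' a p)
  rw [← hcyc, hbd] at r1
  have r2 := koszulBetti_add hNm a p
  have r3 := koszulBetti_add hNm' a p
  omega

/-- If exactly one face `T` lies in `P'` but not in `P`, and `T` occurs in the boundary of a simplex
all of whose facets lie in `P'`, then the Koszul homology grows in degree `|T|` only. -/
theorem koszulBetti_eq_of_unique_face [FiniteDimensional K E] {P P' : Set (Fin n → ℤ)}
    (hP : IsUpperSet P) (hP' : IsUpperSet P') (hPP' : P ⊆ P') {a : Fin n → ℤ} (T : Finset (Fin n))
    (hT : ∀ S, a - squarefreeMultidegree S ∈ P' \ P ↔ S = T) {x : Fin n} (hx : x ∉ T)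
    (hTx : ∀ y ∈ T, a - squarefreeMultidegree ((insert x T).erase y) ∈ P) (p : ℕ) :
    koszulBetti (indicatorFiltration K E P') a p = koszulBetti (indicatorFiltration K E P) a p +
      if p = T.card then Module.finrank K E else 0 := by
  classical
  set N := indicatorFiltration K E P with hN
  set N' := indicatorFiltration K E P' with hN'
  have hNm : Monotone N := indicatorFiltration_mono hP
  have hNm' : Monotone N' := indicatorFiltration_mono hP'
  have hchain : ∀ q, koszulChains N' a q ⊓ LinearMap.ker (LinearMap.proj T) =
      koszulChains N a q := by
    intro q
    refine le_antisymm ?_ (le_inf (koszulChains_indicator_mono hPP' a q) ?_)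
    · rintro ω ⟨h1, h2⟩
      rw [SetLike.mem_coe, mem_koszulChains_indicator] at h1
      rw [mem_koszulChains_indicator]
      refine fun S => ⟨fun hS => ?_, (h1 S).2⟩
      by_cases hS' : a - squarefreeMultidegree S ∈ P'
      · rw [(hT S).mp ⟨hS', hS⟩]; exact h2
      · exact (h1 S).1 hS'
    · intro ω hω
      rw [mem_koszulChains_indicator] at hω
      exact (hω T).1 ((hT T).mpr rfl).2
  have hchain' : ∀ q, q ≠ T.card → koszulChains N' a q = koszulChains N a q := by
    intro q hq
    rw [← hchain q]
    refine (inf_eq_left.mpr fun ω hω => ?_).symm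
    exact (hω T).2 hq.symm
  -- the boundary of the simplex `T ∪ {x}` with coefficient `v`
  set s : E → Finset (Fin n) → E := fun v => boundary K E n (Pi.single (insert x T) v) with hs
  have hsT : ∀ v, s v T = faceSign K x T • v := by
    intro v
    simp only [hs, boundary_apply]
    rw [Finset.sum_eq_single x]
    · rw [if_neg hx, Pi.single_eq_same]
    · intro k _ hk
      split_ifs with hkT
      · rfl
      · rw [Pi.single_eq_of_ne, smul_zero]
        intro h
        have : k ∈ insert x T := h ▸ Finset.mem_insert_self k T
        rcases Finset.mem_insert.mp this with h' | h'
        exacts [hk h', hkT h']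
    · simp
  have hsmem : ∀ v, s v ∈ koszulChains N' a T.card := by
    intro v
    rw [mem_koszulChains_indicator]
    refine fun S => ⟨fun hS => ?_, fun hS => ?_⟩
    · simp only [hs, boundary_apply]
      refine Finset.sum_eq_zero fun k _ => ?_
      split_ifs with hk
      · rfl
      · rw [Pi.single_eq_of_ne, smul_zero]
        intro h
        have hSk : S = (insert x T).erase k := by rw [← h, Finset.erase_insert hk]
        apply hS
        have hkm : k ∈ insert x T := h ▸ Finset.mem_insert_self k S
        rcases Finset.mem_insert.mp hkm with h' | h'
        · rw [hSk, h', Finset.erase_insert hx]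
          exact ((hT T).mpr rfl).1
        · rw [hSk]; exact hPP' (hTx k h')
    · simp only [hs, boundary_apply]
      refine Finset.sum_eq_zero fun k _ => ?_
      split_ifs with hk
      · rfl
      · rw [Pi.single_eq_of_ne, smul_zero]
        intro h
        have := congrArg Finset.card h
        rw [Finset.card_insert_of_notMem hk, Finset.card_insert_of_notMem hx] at this
        omega
  have hsbd : ∀ v, boundary K E n (s v) = 0 := fun v => boundary_boundary _
  -- The new face creates no new boundaries: its coefficient can be removed by subtracting a
  -- multiple of the sphere `s`, which is a cycle. Hence all the growth is in the cycles.
  have hbound : koszulBoundaries N' a p = koszulBoundaries N a p := by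
    by_cases hp : p + 1 = T.card
    · refine le_antisymm ?_ (Submodule.map_mono (koszulChains_indicator_mono hPP' a (p + 1)))
      rintro _ ⟨ω, hω, rfl⟩
      -- The sign cancels the one in `hsT`, so both terms have the same value at `T`.
      refine ⟨ω - s (faceSign K x T • ω T), ?_, ?_⟩
      · rw [SetLike.mem_coe, ← hchain]
        refine ⟨Submodule.sub_mem _ hω (hp ▸ hsmem _), ?_⟩
        refine LinearMap.mem_ker.mpr ?_
        rw [LinearMap.proj_apply, Pi.sub_apply, hsT, smul_smul, faceSign_mul_self, one_smul,
          sub_self]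
      · rw [map_sub, hsbd, sub_zero]
    · unfold koszulBoundaries
      rw [hchain' _ hp]
  have hcycles : Module.finrank K (koszulCycles N' a p) = Module.finrank K (koszulCycles N a p) +
      if p = T.card then Module.finrank K E else 0 := by
    split_ifs with hp
    · have r := Submodule.finrank_map_add_finrank_inf_ker
        (LinearMap.proj (R := K) (φ := fun _ : Finset (Fin n) => E) T) (koszulCycles N' a p)
      have e1 : koszulCycles N' a p ⊓
          LinearMap.ker (LinearMap.proj (R := K) (φ := fun _ : Finset (Fin n) => E) T) =
          koszulCycles N a p := by
        unfold koszulCycles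
        rw [inf_right_comm, hchain]
      have e2 : (koszulCycles N' a p).map
          (LinearMap.proj (R := K) (φ := fun _ : Finset (Fin n) => E) T) = ⊤ := by
        refine eq_top_iff.mpr fun v _ => ⟨s (faceSign K x T • v), ⟨hp ▸ hsmem _, hsbd _⟩, ?_⟩
        rw [LinearMap.proj_apply, hsT, smul_smul, faceSign_mul_self, one_smul]
      rw [e1, e2, finrank_top] at r
      omega
    · unfold koszulCycles
      rw [hchain' _ hp, add_zero]
  have r2 := koszulBetti_add hNm a p
  have r3 := koszulBetti_add hNm' a p
  rw [hbound] at r3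
  omega

/-- The up-set obtained from `P` by adding the multidegrees above `e` that exceed `e` at some
vertex of `X`. -/
def adjoinAbove (P : Set (Fin n → ℤ)) (e : Fin n → ℤ) (X : Finset (Fin n)) : Set (Fin n → ℤ) :=
  P ∪ {c | e ≤ c ∧ ∃ x ∈ X, e x + 1 ≤ c x}

theorem IsUpperSet.adjoinAbove {P : Set (Fin n → ℤ)} (hP : IsUpperSet P) (e : Fin n → ℤ)
    (X : Finset (Fin n)) : IsUpperSet (adjoinAbove P e X) := by
  rintro c c' hcc (h | ⟨h, x, hx, hxc⟩)
  · exact Or.inl (hP hcc h)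
  · exact Or.inr ⟨h.trans hcc, x, hx, hxc.trans (hcc x)⟩

theorem adjoinAbove_insert (P : Set (Fin n → ℤ)) (e : Fin n → ℤ) (x : Fin n)
    (X : Finset (Fin n)) :
    adjoinAbove P e (insert x X) = adjoinAbove (adjoinAbove P e X) e {x} := by
  ext c
  simp only [adjoinAbove, Set.mem_union, Set.mem_ofPred_eq, Finset.mem_insert,
    Finset.mem_singleton, exists_eq_or_imp, exists_eq_left]
  grind

/-- Above `e` the set `P` looks like the ideal generated by the variables `x_y`, `y ∈ Y`, so the
added multidegrees are free in the directions outside `Y` and rigid along `Y`. A direction with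
slack gives a cone; without slack the face is determined by `a`. -/
theorem koszulBetti_adjoinAbove_singleton [FiniteDimensional K E] {P : Set (Fin n → ℤ)}
    (hP : IsUpperSet P) (e : Fin n → ℤ) (Y : Finset (Fin n))
    (hY : ∀ c, e ≤ c → (c ∈ P ↔ ∃ y ∈ Y, e y + 1 ≤ c y)) {x : Fin n} (hx : x ∉ Y)
    (a : Fin n → ℤ) (p : ℕ)
    [Decidable (∃ T ⊆ Y, T.card = p ∧ a = e + squarefreeMultidegree (insert x T))] :
    koszulBetti (indicatorFiltration K E (adjoinAbove P e {x})) a p =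
      koszulBetti (indicatorFiltration K E P) a p +
      if ∃ T ⊆ Y, T.card = p ∧ a = e + squarefreeMultidegree (insert x T)
      then Module.finrank K E else 0 := by
  set P' := adjoinAbove P e {x} with hP'def
  have hP' : IsUpperSet P' := hP.adjoinAbove e _
  have hPP' : P ⊆ P' := Set.subset_union_left
  have hdiff : ∀ c, c ∈ P' \ P ↔ e ≤ c ∧ e x + 1 ≤ c x ∧ ∀ y ∈ Y, c y = e y := by
    intro c
    constructor
    · rintro ⟨h | ⟨h, x', hx', hxc⟩, hc⟩
      · exact absurd h hc
      · rw [Finset.mem_singleton] at hx'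
        subst hx'
        rw [hY c h] at hc
        push Not at hc
        exact ⟨h, hxc, fun y hy => le_antisymm (by have := hc y hy; omega) (h y)⟩
    · rintro ⟨h, hxc, hy⟩
      refine ⟨Or.inr ⟨h, x, by simp, hxc⟩, ?_⟩
      rw [hY c h]
      rintro ⟨y, hyY, hyc⟩
      have := hy y hyY
      omega
  have hsf0 : ∀ (S : Finset (Fin n)) k, k ∉ S → squarefreeMultidegree S k = 0 := fun S k h => by
    simp [squarefreeMultidegree, h]
  have hsf1 : ∀ (S : Finset (Fin n)) k, k ∈ S → squarefreeMultidegree S k = 1 := fun S k h => by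
    simp [squarefreeMultidegree, h]
  -- Here `a j` exceeds by at least one the lower bound imposed at `j`, namely `e j`, or `e j + 1`
  -- when `j = x`. Toggling `j` in a face then never affects membership in `P' \ P`.
  by_cases hcone : ∃ j, j ∉ Y ∧ e j + squarefreeMultidegree {x} j + 1 ≤ a j
  · obtain ⟨j, hjY, hj⟩ := hcone
    rw [koszulBetti_eq_of_cone hP hP' hPP' j, if_neg, add_zero]
    · rintro ⟨T, hTY, -, rfl⟩
      have h1 := hsf0 T j fun h => hjY (hTY h)
      rw [squarefreeMultidegree_insert fun h => hx (hTY h)] at hj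
      have h2 : squarefreeMultidegree {x} j = (Pi.single x 1 : Fin n → ℤ) j := by
        simp [squarefreeMultidegree, Pi.single_apply]
      simp only [Pi.add_apply] at hj
      omega
    · intro S hjS
      rw [hdiff, hdiff]
      have hk : ∀ k, k ≠ j →
          squarefreeMultidegree (insert j S) k = squarefreeMultidegree S k := fun k hk => by
        simp [squarefreeMultidegree, hk]
      have hj0 := hsf0 S j hjS
      have hj1 := hsf1 (insert j S) j (Finset.mem_insert_self j S)
      have hx0 : 0 ≤ squarefreeMultidegree {x} j := by
        simp only [squarefreeMultidegree]; split_ifs <;> simp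
      simp only [Pi.le_def, Pi.sub_apply]
      refine and_congr ?_ (and_congr ?_ ?_)
      · refine forall_congr' fun k => ?_
        by_cases hkj : k = j
        · subst hkj; rw [hj0, hj1]; constructor <;> intro <;> omega
        · rw [hk k hkj]
      · by_cases hkj : x = j
        · subst hkj
          have := hsf1 {x} x (by simp)
          rw [hj0, hj1]; constructor <;> intro <;> omega
        · rw [hk x hkj]
      · refine forall₂_congr fun y hy => ?_
        rw [hk y (ne_of_mem_of_not_mem hy hjY)]
  · push Not at hcone
    have hface : ∀ S, a - squarefreeMultidegree S ∈ P' \ P ↔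
        S ⊆ Y ∧ a = e + squarefreeMultidegree (insert x S) := by
      intro S
      rw [hdiff]
      simp only [Pi.le_def, Pi.sub_apply]
      constructor
      · rintro ⟨h1, h2, h3⟩
        have hSY : S ⊆ Y := by
          intro k hk
          by_contra hkY
          have h4 := hcone k hkY
          have h5 := hsf1 S k hk
          have h6 := h1 k
          by_cases hkx : k = x
          · subst hkx
            have := hsf1 {k} k (by simp)
            omega
          · have := hsf0 {x} k (by simpa using hkx)
            omega
        refine ⟨hSY, funext fun k => ?_⟩
        rw [Pi.add_apply]
        by_cases hkY : k ∈ Y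
        · have h4 := h3 k hkY
          have h5 : squarefreeMultidegree (insert x S) k = squarefreeMultidegree S k := by
            simp [squarefreeMultidegree, ne_of_mem_of_not_mem hkY hx]
          omega
        · have h4 := hcone k hkY
          have h5 := hsf0 S k fun h => hkY (hSY h)
          have h6 := h1 k
          by_cases hkx : k = x
          · subst hkx
            have := hsf1 {k} k (by simp)
            have := hsf1 (insert k S) k (by simp)
            omega
          · have := hsf0 {x} k (by simpa using hkx)
            have := hsf0 (insert x S) k (by
              simpa [hkx] using fun h => hkY (hSY h))
            omega
      · rintro ⟨hSY, rfl⟩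
        have hxS : x ∉ S := fun h => hx (hSY h)
        rw [squarefreeMultidegree_insert hxS]
        refine ⟨fun k => ?_, ?_, fun y hy => ?_⟩
        · simp only [Pi.add_apply, Pi.single_apply]; split_ifs <;> omega
        · simp only [Pi.add_apply, Pi.single_eq_same]; omega
        · simp only [Pi.add_apply, Pi.single_eq_of_ne (ne_of_mem_of_not_mem hy hx)]; omega
    by_cases hex : ∃ T ⊆ Y, a = e + squarefreeMultidegree (insert x T)
    · obtain ⟨T, hTY, rfl⟩ := hex
      have hxT : x ∉ T := fun h => hx (hTY h)
      have huniq : ∀ S, S ⊆ Y ∧ e + squarefreeMultidegree (insert x T) =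
          e + squarefreeMultidegree (insert x S) ↔ S = T := by
        intro S
        constructor
        · rintro ⟨hSY, h⟩
          have hxS : x ∉ S := fun h => hx (hSY h)
          rw [squarefreeMultidegree_insert hxS, squarefreeMultidegree_insert hxT] at h
          have h' := add_right_cancel (add_left_cancel h)
          ext k
          have := congrFun h' k
          simp only [squarefreeMultidegree] at this
          by_cases h1 : k ∈ S <;> by_cases h2 : k ∈ T <;> simp_all
        · rintro rfl
          exact ⟨hTY, rfl⟩
      rw [koszulBetti_eq_of_unique_face hP hP' hPP' T (fun S => (hface S).trans (huniq S)) hxT]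
      · congr 1
        refine if_congr ⟨fun h => ⟨T, hTY, h.symm, rfl⟩, ?_⟩ rfl rfl
        rintro ⟨S, hSY, hS, h⟩
        rw [← hS, (huniq S).mp ⟨hSY, h⟩]
      · intro y hy
        have hyx : y ≠ x := ne_of_mem_of_not_mem hy hxT
        -- Omitting `y` from the simplex leaves multidegree `e + 1_y`, which lies in `P` because `y
        -- ∈ Y`.
        have h1 : e + squarefreeMultidegree (insert x T) -
            squarefreeMultidegree ((insert x T).erase y) = e + Pi.single y 1 := by
          have := squarefreeMultidegree_insert (Finset.notMem_erase y (insert x T))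
          rw [Finset.insert_erase (Finset.mem_insert_of_mem hy)] at this
          rw [this]; abel
        rw [h1, hY]
        · exact ⟨y, hTY hy, by simp⟩
        · intro k
          simp only [Pi.add_apply, Pi.single_apply]; split_ifs <;> omega
    · rw [if_neg fun ⟨T, hT, _, h⟩ => hex ⟨T, hT, h⟩, add_zero]
      refine koszulBetti_congr_of_forall (fun S => ?_) p
      have h1 : ¬ (a - squarefreeMultidegree S ∈ P' \ P) := by
        rw [hface]; exact fun h => hex ⟨S, h⟩
      ext v
      rw [mem_indicatorFiltration, mem_indicatorFiltration]
      by_cases h2 : a - squarefreeMultidegree S ∈ P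
      · simp [h2, hPP' h2]
      · have h3 : a - squarefreeMultidegree S ∉ P' := fun h => h1 ⟨h, h2⟩
        simp [h2, h3]

theorem squarefreeMultidegree_injective :
    Function.Injective (squarefreeMultidegree : Finset (Fin n) → Fin n → ℤ) := by
  intro S T h
  ext k
  have := congrFun h k
  simp only [squarefreeMultidegree] at this
  by_cases h1 : k ∈ S <;> by_cases h2 : k ∈ T <;> simp_all

open Classical in
-- Once the vertices of `X` have been adjoined, the hypothesis on `Y` holds for `X ∪ Y`, so the
-- one-vertex step can be iterated. The next vertex `x` accounts for exactly the sets `S` containing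
-- it, through `T = S \ {x}`; this is the shift from `p` to `p + 1`.
theorem koszulBetti_adjoinAbove [FiniteDimensional K E] {P : Set (Fin n → ℤ)}
    (hP : IsUpperSet P) (e : Fin n → ℤ) (X Y : Finset (Fin n)) (hXY : Disjoint X Y)
    (hY : ∀ c, e ≤ c → (c ∈ P ↔ ∃ y ∈ Y, e y + 1 ≤ c y)) (a : Fin n → ℤ) (p : ℕ) :
    koszulBetti (indicatorFiltration K E (adjoinAbove P e X)) a p =
      koszulBetti (indicatorFiltration K E P) a p +
      if ∃ S ⊆ X ∪ Y, S.card = p + 1 ∧ ¬ S ⊆ Y ∧ a = e + squarefreeMultidegree S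
      then Module.finrank K E else 0 := by
  induction X using Finset.induction_on with
  | empty =>
    have h0 : adjoinAbove P e ∅ = P := by simp [adjoinAbove]
    rw [h0, if_neg, add_zero]
    rintro ⟨S, h1, -, h2, -⟩
    rw [Finset.empty_union] at h1
    exact h2 h1
  | insert x X hxX ih =>
    rw [Finset.disjoint_insert_left] at hXY
    have hxXY : x ∉ X ∪ Y := by simp [hxX, hXY.1]
    rw [adjoinAbove_insert, koszulBetti_adjoinAbove_singleton (hP.adjoinAbove e X) e (X ∪ Y) _ hxXY,
      ih hXY.2, add_assoc]
    · congr 1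
      -- The multidegree `a` determines `S`, and `S` either contains `x` or does not, so the old and
      -- new contributions never occur together.
      by_cases h1 : ∃ S ⊆ X ∪ Y, S.card = p + 1 ∧ ¬ S ⊆ Y ∧ a = e + squarefreeMultidegree S
      · rw [if_pos h1, if_neg, add_zero, if_pos]
        · obtain ⟨S, hS, h⟩ := h1
          exact ⟨S, hS.trans (by rw [Finset.insert_union]; exact Finset.subset_insert _ _), h⟩
        · rintro ⟨T, hT, -, h⟩
          obtain ⟨S, hS, -, -, h'⟩ := h1
          have := squarefreeMultidegree_injective (add_left_cancel (h.symm.trans h'))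
          exact hxXY (hS (this ▸ Finset.mem_insert_self x T))
      · rw [if_neg h1, zero_add]
        refine if_congr ⟨?_, ?_⟩ rfl rfl
        · rintro ⟨T, hT, hTp, h⟩
          refine ⟨insert x T, ?_, ?_, ?_, h⟩
          · rw [Finset.insert_union]; exact Finset.insert_subset_insert _ hT
          · rw [Finset.card_insert_of_notMem fun h => hxXY (hT h), hTp]
          · exact fun h => hXY.1 (h (Finset.mem_insert_self x T))
        · rintro ⟨S, hS, hSp, hSY, h⟩
          rw [Finset.insert_union] at hS
          by_cases hxS : x ∈ S
          · refine ⟨S.erase x, ?_, ?_, ?_⟩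
            · rw [← Finset.subset_insert_iff]; exact hS
            · rw [Finset.card_erase_of_mem hxS, hSp]; rfl
            · rw [Finset.insert_erase hxS]; exact h
          · exact absurd ⟨S, (Finset.subset_insert_iff_of_notMem hxS).mp hS, hSp, hSY, h⟩ h1
    · intro c hc
      simp only [adjoinAbove, Set.mem_union, Set.mem_ofPred_eq, hY c hc, hc, true_and,
        Finset.mem_union, or_and_right, exists_or]
      exact or_comm

end UpSet

/-! ### Multigraded maps of free modules, dehomogenised -/

section Dehomogenize

variable {n : ℕ} {K : Type*} [Field K]

theorem weight_single_one (m : Fin n →₀ ℕ) :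
    Finsupp.weight (fun j : Fin n => (Pi.single j 1 : Fin n → ℤ)) m = fun j => (m j : ℤ) := by
  funext j
  simp [Finsupp.weight_apply, Finsupp.sum_fintype, Finset.sum_apply, Pi.single_apply]

/-- The exponent vector with the same positive part as `c`. -/
noncomputable def toExponent (c : Fin n → ℤ) : Fin n →₀ ℕ :=
  Finsupp.equivFunOnFinite.symm fun j => (c j).toNat

theorem toExponent_apply (c : Fin n → ℤ) (j : Fin n) : toExponent c j = (c j).toNat := rfl

theorem coe_toExponent {c : Fin n → ℤ} (hc : 0 ≤ c) : (fun j => (toExponent c j : ℤ)) = c :=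
  funext fun j => Int.toNat_of_nonneg (hc j)

theorem toExponent_coe (m : Fin n →₀ ℕ) : toExponent (fun j => (m j : ℤ)) = m := by
  ext j; simp [toExponent_apply]

open Classical in
variable (K) in
/-- The coefficient in multidegree `c`. -/
noncomputable def coeffAt (c : Fin n → ℤ) : MvPolynomial (Fin n) K →ₗ[K] K :=
  if 0 ≤ c then MvPolynomial.lcoeff K (toExponent c) else 0

theorem coeffAt_of_nonneg {c : Fin n → ℤ} (hc : 0 ≤ c) (f : MvPolynomial (Fin n) K) :
    coeffAt K c f = f.coeff (toExponent c) := by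
  rw [coeffAt, if_pos hc]; rfl

theorem coeffAt_of_not_nonneg {c : Fin n → ℤ} (hc : ¬ 0 ≤ c) (f : MvPolynomial (Fin n) K) :
    coeffAt K c f = 0 := by
  rw [coeffAt, if_neg hc]; rfl

open Classical in
/-- The multihomogeneous polynomial of multidegree `c` with coefficient `k`. -/
noncomputable def monomialAt (c : Fin n → ℤ) (k : K) : MvPolynomial (Fin n) K :=
  if 0 ≤ c then MvPolynomial.monomial (toExponent c) k else 0

theorem isMultihomogeneous_monomialAt (c : Fin n → ℤ) (k : K) :
    IsMultihomogeneous (monomialAt c k) c := by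
  unfold monomialAt
  split_ifs with h
  · exact MvPolynomial.isWeightedHomogeneous_monomial _ _ _
      ((weight_single_one _).trans (coe_toExponent h))
  · exact MvPolynomial.isWeightedHomogeneous_zero _ _ _

theorem coeffAt_monomialAt {c : Fin n → ℤ} (hc : 0 ≤ c) (k : K) :
    coeffAt K c (monomialAt c k) = k := by
  rw [coeffAt_of_nonneg hc, monomialAt, if_pos hc, MvPolynomial.coeff_monomial, if_pos rfl]

theorem IsMultihomogeneous.eq_monomialAt {f : MvPolynomial (Fin n) K} {c : Fin n → ℤ}
    (hf : IsMultihomogeneous f c) : f = monomialAt c (coeffAt K c f) := by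
  have h : ∀ m, f.coeff m ≠ 0 → (fun j => (m j : ℤ)) = c := fun m hm => by
    rw [← weight_single_one]; exact hf hm
  unfold monomialAt
  split_ifs with hc
  · ext m
    rw [MvPolynomial.coeff_monomial, coeffAt_of_nonneg hc]
    split_ifs with hm
    · rw [hm]
    · by_contra h0
      exact hm (by rw [← h m h0, toExponent_coe])
  · ext m
    rw [MvPolynomial.coeff_zero]
    by_contra h0
    exact hc (h m h0 ▸ fun j => Int.natCast_nonneg _)

/-- Multihomogeneity of `g` leaves a single term in the convolution. The identity also holds outside
the positive orthant: there the factor at `a` is `0`, and no monomial of `f` can reach multidegree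
`a + b`. -/
theorem coeffAt_mul {f g : MvPolynomial (Fin n) K} {b : Fin n → ℤ}
    (hg : IsMultihomogeneous g b) (a : Fin n → ℤ) :
    coeffAt K (a + b) (f * g) = coeffAt K a f * coeffAt K b g := by
  rw [hg.eq_monomialAt]
  generalize coeffAt K b g = k
  by_cases hb : 0 ≤ b
  swap
  · simp [monomialAt, hb]
  rw [coeffAt_monomialAt hb, monomialAt, if_pos hb]
  by_cases ha : 0 ≤ a
  · have hab : toExponent (a + b) = toExponent a + toExponent b := by
      ext j
      simp only [toExponent_apply, Finsupp.add_apply, Pi.add_apply]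
      exact Int.toNat_add (ha j) (hb j)
    rw [coeffAt_of_nonneg (add_nonneg ha hb), coeffAt_of_nonneg ha, hab,
      MvPolynomial.coeff_mul_monomial]
  · rw [coeffAt_of_not_nonneg ha, zero_mul]
    by_cases hab : 0 ≤ a + b
    · rw [coeffAt_of_nonneg hab, MvPolynomial.coeff_mul_monomial', if_neg]
      intro h
      apply ha
      intro j
      have h1 := h j
      have h2 := hab j
      have h3 := hb j
      simp only [toExponent_apply, Pi.add_apply, Pi.zero_apply] at h1 h2 h3 ⊢
      omega
    · rw [coeffAt_of_not_nonneg hab]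

theorem IsMultihomogeneous.mul {f g : MvPolynomial (Fin n) K} {a b : Fin n → ℤ}
    (hf : IsMultihomogeneous f a) (hg : IsMultihomogeneous g b) :
    IsMultihomogeneous (f * g) (a + b) :=
  MvPolynomial.IsWeightedHomogeneous.mul hf hg

/-! ### Graded pieces of free modules and of the maps between them -/

variable {ι κ : Type*}

/-- The coefficients in multidegree `c` of an element of the free module with basis vectors of
multidegrees `deg`. -/
noncomputable def coeffsAt (deg : ι → (Fin n → ℤ)) (c : Fin n → ℤ)
    (w : ι → MvPolynomial (Fin n) K) : ι → K :=
  fun b => coeffAt K (c - deg b) (w b)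

/-- A section of `coeffsAt` over `freeFiltration K deg c`; entries whose basis vector does not
satisfy `deg b ≤ c` are discarded. -/
noncomputable def homogenize (deg : ι → (Fin n → ℤ)) (c : Fin n → ℤ) (v : ι → K) :
    ι → MvPolynomial (Fin n) K :=
  fun b => monomialAt (c - deg b) (v b)

theorem coeffsAt_mem (deg : ι → (Fin n → ℤ)) (c : Fin n → ℤ) (w : ι → MvPolynomial (Fin n) K) :
    coeffsAt deg c w ∈ freeFiltration K deg c :=
  fun _ hb => coeffAt_of_not_nonneg (fun h => hb (sub_nonneg.mp h)) _

theorem coeffsAt_homogenize {deg : ι → (Fin n → ℤ)} {c : Fin n → ℤ} {v : ι → K}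
    (hv : v ∈ freeFiltration K deg c) : coeffsAt deg c (homogenize deg c v) = v := by
  funext b
  by_cases hb : deg b ≤ c
  · exact coeffAt_monomialAt (sub_nonneg.mpr hb) _
  · rw [hv b hb]
    exact coeffAt_of_not_nonneg (fun h => hb (sub_nonneg.mp h)) _

variable [Fintype ι] [DecidableEq ι]

/-- The matrix of a multigraded map of free modules after setting all variables equal to `1`. -/
noncomputable def dehomogenize (deg : ι → (Fin n → ℤ)) (deg' : κ → (Fin n → ℤ))
    (f : (ι → MvPolynomial (Fin n) K) →ₗ[MvPolynomial (Fin n) K] (κ → MvPolynomial (Fin n) K)) :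
    (ι → K) →ₗ[K] (κ → K) :=
  Fintype.linearCombination K fun b k => coeffAt K (deg b - deg' k) (f (Pi.single b 1) k)

variable {deg : ι → (Fin n → ℤ)} {deg' : κ → (Fin n → ℤ)}
  {f : (ι → MvPolynomial (Fin n) K) →ₗ[MvPolynomial (Fin n) K] (κ → MvPolynomial (Fin n) K)}

theorem map_apply_eq_sum
    (f : (ι → MvPolynomial (Fin n) K) →ₗ[MvPolynomial (Fin n) K] (κ → MvPolynomial (Fin n) K))
    (w : ι → MvPolynomial (Fin n) K) (k : κ) : f w k = ∑ b, w b * f (Pi.single b 1) k := by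
  conv_lhs => rw [pi_eq_sum_univ' w]
  rw [map_sum, Finset.sum_apply]
  refine Finset.sum_congr rfl fun b _ => ?_
  rw [map_smul, Pi.smul_apply, smul_eq_mul]

/-- Taking coefficients in multidegree `c` identifies the graded piece with a subspace of `ι → K`,
and a multigraded map then acts by one scalar matrix independent of `c`. -/
theorem coeffsAt_map (hf : ∀ b k, IsMultihomogeneous (f (Pi.single b 1) k) (deg b - deg' k))
    (c : Fin n → ℤ) (w : ι → MvPolynomial (Fin n) K) :
    coeffsAt deg' c (f w) = dehomogenize deg deg' f (coeffsAt deg c w) := by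
  funext k
  rw [dehomogenize, Fintype.linearCombination_apply, Finset.sum_apply, coeffsAt,
    map_apply_eq_sum, map_sum]
  refine Finset.sum_congr rfl fun b _ => ?_
  rw [Pi.smul_apply, smul_eq_mul, coeffsAt, ← coeffAt_mul (hf b k)]
  congr 2; abel

theorem isMultihomogeneous_map_homogenize
    (hf : ∀ b k, IsMultihomogeneous (f (Pi.single b 1) k) (deg b - deg' k))
    (c : Fin n → ℤ) (v : ι → K) (k : κ) :
    IsMultihomogeneous (f (homogenize deg c v) k) (c - deg' k) := by
  rw [map_apply_eq_sum]
  refine (MvPolynomial.weightedHomogeneousSubmodule K _ _).sum_mem fun b _ => ?_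
  have h := (isMultihomogeneous_monomialAt (c - deg b) (v b)).mul (hf b k)
  rwa [sub_add_sub_cancel] at h

theorem map_homogenize_eq_zero
    (hf : ∀ b k, IsMultihomogeneous (f (Pi.single b 1) k) (deg b - deg' k)) {c : Fin n → ℤ}
    {v : ι → K} (hv : v ∈ freeFiltration K deg c) (h : dehomogenize deg deg' f v = 0) :
    f (homogenize deg c v) = 0 := by
  have h1 := coeffsAt_map hf c (homogenize deg c v)
  rw [coeffsAt_homogenize hv, h] at h1
  funext k
  rw [(isMultihomogeneous_map_homogenize hf c v k).eq_monomialAt]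
  have h2 : coeffAt K (c - deg' k) (f (homogenize deg c v) k) = 0 := congrFun h1 k
  rw [h2, monomialAt]
  simp

/-- Exactness passes to the dehomogenised multifiltered sequence. -/
theorem freeFiltration_map_dehomogenize_of_exact {μ : Type*} [Fintype μ] [DecidableEq μ]
    {deg'' : μ → (Fin n → ℤ)}
    {g : (μ → MvPolynomial (Fin n) K) →ₗ[MvPolynomial (Fin n) K] (ι → MvPolynomial (Fin n) K)}
    (hg : ∀ b k, IsMultihomogeneous (g (Pi.single b 1) k) (deg'' b - deg k))
    (hf : ∀ b k, IsMultihomogeneous (f (Pi.single b 1) k) (deg b - deg' k))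
    (h : LinearMap.range g = LinearMap.ker f) (c : Fin n → ℤ) :
    (freeFiltration K deg'' c).map (dehomogenize deg'' deg g) =
      freeFiltration K deg c ⊓ LinearMap.ker (dehomogenize deg deg' f) := by
  ext v
  constructor
  · rintro ⟨u, hu, rfl⟩
    rw [← coeffsAt_homogenize hu, ← coeffsAt_map hg]
    refine ⟨coeffsAt_mem _ _ _, ?_⟩
    refine LinearMap.mem_ker.mpr ?_
    rw [← coeffsAt_map hf]
    have : g (homogenize deg'' c u) ∈ LinearMap.ker f := h ▸ LinearMap.mem_range_self g _
    rw [LinearMap.mem_ker.mp this]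
    funext k
    exact map_zero _
  · rintro ⟨hv, hv'⟩
    have h1 : homogenize deg c v ∈ LinearMap.range g := by
      rw [h]; exact map_homogenize_eq_zero hf hv hv'
    obtain ⟨w, hw⟩ := h1
    refine ⟨coeffsAt deg'' c w, coeffsAt_mem _ _ _, ?_⟩
    rw [← coeffsAt_map hg, hw, coeffsAt_homogenize hv]

/-- Minimality passes to the dehomogenised multifiltered sequence. -/
theorem dehomogenize_apply_eq_zero_of_minimal
    (hf : ∀ b k, IsMultihomogeneous (f (Pi.single b 1) k) (deg b - deg' k))
    (hmin : ∀ w k, f w k ∈ Ideal.span (Set.range (MvPolynomial.X (R := K) (σ := Fin n))))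
    {c : Fin n → ℤ} {v : ι → K} (hv : v ∈ freeFiltration K deg c) {k : κ} (hk : deg' k = c) :
    dehomogenize deg deg' f v k = 0 := by
  rw [← coeffsAt_homogenize hv, ← coeffsAt_map hf, coeffsAt, hk, sub_self,
    coeffAt_of_nonneg le_rfl]
  have h := hmin (homogenize deg c v) k
  rw [← Set.image_univ, MvPolynomial.mem_ideal_span_X_image] at h
  by_contra h0
  obtain ⟨j, -, hj⟩ := h _ (MvPolynomial.mem_support_iff.mpr h0)
  exact hj (by simp [toExponent_apply])

/-! ### Betti numbers as Koszul homology -/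

/-- The multidegrees of the monomials in an ideal. -/
def idealDegrees (I : Ideal (MvPolynomial (Fin n) K)) : Set (Fin n → ℤ) :=
  {c | 0 ≤ c ∧ MvPolynomial.monomial (toExponent c) (1 : K) ∈ I}

theorem isUpperSet_idealDegrees (I : Ideal (MvPolynomial (Fin n) K)) :
    IsUpperSet (idealDegrees I) := by
  rintro c c' hcc ⟨hc, h⟩
  refine ⟨hc.trans hcc, ?_⟩
  have h1 : toExponent c' = (toExponent c' - toExponent c) + toExponent c := by
    rw [tsub_add_cancel_of_le]
    intro j
    simp only [toExponent_apply]
    exact Int.toNat_le_toNat (hcc j)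
  rw [h1, ← one_mul (1 : K), ← MvPolynomial.monomial_mul]
  exact I.mul_mem_left _ h

/-! ### Dimension shifting along a minimal resolution -/

namespace MinimalMultigradedFreeResolution

variable {I : Ideal (MvPolynomial (Fin n) K)} (F : MinimalMultigradedFreeResolution I)

/-- The augmentation as a map into a free module of rank one. -/
noncomputable def augPi : (Fin (F.rank 0) → MvPolynomial (Fin n) K) →ₗ[MvPolynomial (Fin n) K]
    (Fin 1 → MvPolynomial (Fin n) K) :=
  LinearMap.pi fun _ => F.aug

theorem augPi_apply (w : Fin (F.rank 0) → MvPolynomial (Fin n) K) (k : Fin 1) :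
    F.augPi w k = F.aug w := rfl

theorem ker_augPi : LinearMap.ker F.augPi = LinearMap.ker F.aug := by
  ext w
  exact ⟨fun h => congrFun h 0, fun h => funext fun _ => h⟩

theorem augPi_homogeneous (b : Fin (F.rank 0)) (k : Fin 1) :
    IsMultihomogeneous (F.augPi (Pi.single b 1) k) (F.deg 0 b - (fun _ => 0 : Fin 1 → _) k) := by
  rw [sub_zero]; exact F.aug_homogeneous b

theorem freeFiltration_map_dehomogenize_augPi (c : Fin n → ℤ) :
    (freeFiltration K (F.deg 0) c).map (dehomogenize (F.deg 0) (fun _ => 0) F.augPi) =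
      indicatorFiltration K (Fin 1 → K) (idealDegrees I) c := by
  ext v
  rw [mem_indicatorFiltration]
  constructor
  · rintro ⟨u, hu, rfl⟩ hc
    rw [← coeffsAt_homogenize hu, ← coeffsAt_map F.augPi_homogeneous]
    funext k
    rw [coeffsAt, Pi.zero_apply, sub_zero]
    by_contra h0
    have h1 := isMultihomogeneous_map_homogenize F.augPi_homogeneous c u k
    rw [sub_zero] at h1
    have hc0 : 0 ≤ c := by
      by_contra h2
      exact h0 (coeffAt_of_not_nonneg h2 _)
    have h2 := h1.eq_monomialAt
    have h3 : F.augPi (homogenize (F.deg 0) c u) k ∈ I := by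
      exact F.range_aug.le (LinearMap.mem_range_self F.aug _)
    refine hc ⟨hc0, ?_⟩
    rw [h2, monomialAt, if_pos hc0] at h3
    -- A nonzero element of `I` of multidegree `c` is a scalar multiple of one monomial; dividing by
    -- the scalar puts that monomial in `I`.
    have h4 := I.mul_mem_left
      (MvPolynomial.C (coeffAt K c (F.augPi (homogenize (F.deg 0) c u) k))⁻¹) h3
    rwa [MvPolynomial.C_mul_monomial, inv_mul_cancel₀ h0] at h4
  · intro hv
    by_cases hc : c ∈ idealDegrees I
    · have h1 : monomialAt c (v 0) ∈ LinearMap.range F.aug := by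
        rw [F.range_aug, monomialAt, if_pos hc.1, ← mul_one (v 0), ← MvPolynomial.C_mul_monomial]
        exact I.mul_mem_left _ hc.2
      obtain ⟨w, hw⟩ := h1
      refine ⟨coeffsAt (F.deg 0) c w, coeffsAt_mem _ _ _, ?_⟩
      rw [← coeffsAt_map F.augPi_homogeneous]
      funext k
      rw [coeffsAt, augPi_apply, hw, sub_zero, coeffAt_monomialAt hc.1, Subsingleton.elim 0 k]
    · rw [hv hc]; exact zero_mem _

/-- The dehomogenised syzygies. -/
noncomputable def syzygyFiltration : (i : ℕ) → (Fin n → ℤ) → Submodule K (Fin (F.rank i) → K)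
  | 0 => fun c => freeFiltration K (F.deg 0) c ⊓
      LinearMap.ker (dehomogenize (F.deg 0) (fun _ => 0) F.augPi)
  | i + 1 => fun c => freeFiltration K (F.deg (i + 1)) c ⊓
      LinearMap.ker (dehomogenize (F.deg (i + 1)) (F.deg i) (F.d i))

theorem freeFiltration_map_dehomogenize_d (i : ℕ) (c : Fin n → ℤ) :
    (freeFiltration K (F.deg (i + 1)) c).map (dehomogenize (F.deg (i + 1)) (F.deg i) (F.d i)) =
      F.syzygyFiltration i c := by
  cases i with
  | zero =>
    exact freeFiltration_map_dehomogenize_of_exact (F.d_homogeneous 0) F.augPi_homogeneous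
      (F.exact_zero.trans F.ker_augPi.symm) c
  | succ i =>
    exact freeFiltration_map_dehomogenize_of_exact (F.d_homogeneous (i + 1)) (F.d_homogeneous i)
      (F.exact_succ i) c

theorem syzygyFiltration_mono (i : ℕ) : Monotone (F.syzygyFiltration i) := by
  intro c c' hcc
  rw [← freeFiltration_map_dehomogenize_d, ← freeFiltration_map_dehomogenize_d]
  exact Submodule.map_mono (freeFiltration_mono _ hcc)

theorem syzygyFiltration_apply_eq_zero (i : ℕ) (c : Fin n → ℤ) (v : Fin (F.rank i) → K)
    (hv : v ∈ F.syzygyFiltration i c) (b : Fin (F.rank i)) (hb : F.deg i b = c) : v b = 0 := by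
  rw [← freeFiltration_map_dehomogenize_d] at hv
  obtain ⟨u, hu, rfl⟩ := hv
  exact dehomogenize_apply_eq_zero_of_minimal (F.d_homogeneous i) (F.minimal i) hu hb

/-- Each shift lowers the Koszul degree by one and passes to the next syzygies, until degree zero
counts basis vectors. Since `syzygyFiltration i` lies in `F i` and is covered by `F (i + 1)`, the
index is `i + 1 + p`. -/
theorem koszulBetti_syzygyFiltration (a : Fin n → ℤ) (p i : ℕ) :
    koszulBetti (F.syzygyFiltration i) a p = F.multiplicity (i + 1 + p) a := by
  induction p generalizing i with
  | zero =>
    exact koszulBetti_zero_of_cover _ (F.syzygyFiltration_mono i)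
      (F.freeFiltration_map_dehomogenize_d i) (F.syzygyFiltration_apply_eq_zero (i + 1)) a
  | succ p ih =>
    rw [koszulBetti_succ_of_cover _ (F.syzygyFiltration_mono i)
      (F.freeFiltration_map_dehomogenize_d i) (F.syzygyFiltration_apply_eq_zero (i + 1))]
    have h := ih (i + 1)
    rw [show i + 1 + (p + 1) = i + 1 + 1 + p by ring, ← h]
    rfl

/-- The multiplicities of a minimal resolution are the dimensions of Koszul homology. -/
theorem multiplicity_eq_koszulBetti (i : ℕ) (a : Fin n → ℤ) :
    F.multiplicity i a =
      koszulBetti (indicatorFiltration K (Fin 1 → K) (idealDegrees I)) a i := by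
  have hm := indicatorFiltration_mono (K := K) (E := Fin 1 → K) (isUpperSet_idealDegrees I)
  cases i with
  | zero =>
    exact (koszulBetti_zero_of_cover _ hm F.freeFiltration_map_dehomogenize_augPi
      (F.syzygyFiltration_apply_eq_zero 0) a).symm
  | succ i =>
    rw [koszulBetti_succ_of_cover _ hm F.freeFiltration_map_dehomogenize_augPi
      (F.syzygyFiltration_apply_eq_zero 0)]
    have h := F.koszulBetti_syzygyFiltration a i 0
    rw [show 0 + 1 + i = i + 1 by ring] at h
    exact h.symm

end MinimalMultigradedFreeResolution

/-- The right-hand side does not mention a resolution, so the one chosen in the definition of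
`multigradedBetti` is immaterial. -/
theorem IsMonomialIdeal.multigradedBetti_eq {I : Ideal (MvPolynomial (Fin n) K)}
    (hI : IsMonomialIdeal I) (i : ℕ) (a : Fin n → ℤ) :
    multigradedBetti I i a =
      koszulBetti (indicatorFiltration K (Fin 1 → K) (idealDegrees I)) a i := by
  rw [multigradedBetti, dif_pos hI.nonempty_resolution]
  exact MinimalMultigradedFreeResolution.multiplicity_eq_koszulBetti _ i a

theorem finite_support_multigradedBetti (I : Ideal (MvPolynomial (Fin n) K)) (i : ℕ) :
    (Function.support (multigradedBetti I i)).Finite := by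
  by_cases h : Nonempty (MinimalMultigradedFreeResolution I)
  · refine (Set.finite_range (h.some.deg i)).subset fun a ha => ?_
    rw [Function.mem_support, multigradedBetti, dif_pos h,
      MinimalMultigradedFreeResolution.multiplicity, Finset.card_ne_zero] at ha
    obtain ⟨b, hb⟩ := ha
    exact ⟨b, (Finset.mem_filter.mp hb).2⟩
  · convert Set.finite_empty
    ext a
    simp [multigradedBetti, h]

end Dehomogenize

/-! ### Circuit ideals -/

section Clutter

variable {n : ℕ} {K : Type*} [Field K]

theorem squarefreeMonomial_eq_monomial (K : Type*) [Field K] (F : Finset (Fin n)) :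
    squarefreeMonomial K F = MvPolynomial.monomial (∑ i ∈ F, Finsupp.single i 1) (1 : K) := by
  rw [MvPolynomial.monomial_sum_one]; rfl

theorem sum_single_one_apply (F : Finset (Fin n)) (j : Fin n) :
    (∑ i ∈ F, Finsupp.single i 1 : Fin n →₀ ℕ) j = if j ∈ F then 1 else 0 := by
  simp [Finsupp.finsetSum_apply, Finsupp.single_apply]

theorem monomial_mem_circuitIdeal {C : Finset (Finset (Fin n))} {m : Fin n →₀ ℕ} :
    MvPolynomial.monomial m (1 : K) ∈ circuitIdeal K C ↔ ∃ G ∈ C, ∀ i ∈ G, 1 ≤ m i := by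
  have h : circuitIdeal K C = Ideal.span ((fun s => MvPolynomial.monomial s (1 : K)) ''
      ((fun F : Finset (Fin n) => ∑ i ∈ F, Finsupp.single i 1) '' (C : Set (Finset (Fin n))))) := by
    unfold circuitIdeal
    congr 1
    ext f
    simp only [← Set.image_comp, Set.mem_image, Function.comp, SetLike.mem_coe,
      ← squarefreeMonomial_eq_monomial]
    exact exists_congr fun F => and_congr_right fun _ => eq_comm
  rw [h, MvPolynomial.mem_ideal_span_monomial_image]
  simp only [MvPolynomial.mem_support_iff, MvPolynomial.coeff_monomial, ne_eq, ite_eq_right_iff,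
    one_ne_zero, imp_false, not_not, forall_eq', Set.exists_mem_image, SetLike.mem_coe]
  refine exists_congr fun G => and_congr_right fun _ => ⟨fun h i hi => ?_, fun h i => ?_⟩
  · have := h i
    rwa [sum_single_one_apply, if_pos hi] at this
  · rw [sum_single_one_apply]
    split_ifs with hi
    exacts [h i hi, Nat.zero_le _]

theorem mem_idealDegrees_circuitIdeal {C : Finset (Finset (Fin n))} {c : Fin n → ℤ} (hc : 0 ≤ c) :
    c ∈ idealDegrees (circuitIdeal K C) ↔ ∃ G ∈ C, ∀ i ∈ G, 1 ≤ c i := by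
  rw [idealDegrees, Set.mem_ofPred_eq, monomial_mem_circuitIdeal]
  simp only [hc, true_and, toExponent_apply]
  refine exists_congr fun G => and_congr_right fun _ => forall₂_congr fun i _ => ?_
  have := hc i
  simp only [Pi.zero_apply] at this
  omega

theorem X_mul_squarefreeMonomial (i : Fin n) (e : Finset (Fin n)) :
    MvPolynomial.X i * squarefreeMonomial K e =
      MvPolynomial.monomial (Finsupp.single i 1 + ∑ k ∈ e, Finsupp.single k 1) (1 : K) := by
  rw [squarefreeMonomial_eq_monomial, MvPolynomial.X, MvPolynomial.monomial_mul, one_mul]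

/-- A circuit whose monomial divides `x_i x_e` is contained in `e ∪ {i}` and has `|e| + 1` elements,
so it fills `e ∪ {i}` and `i ∉ e`. -/
theorem X_mul_squarefreeMonomial_mem_circuitIdeal {C : Finset (Finset (Fin n))} (i : Fin n)
    (e : Finset (Fin n)) (hC : ∀ F ∈ C, F.card = e.card + 1) :
    MvPolynomial.X i * squarefreeMonomial K e ∈ circuitIdeal K C ↔ i ∉ e ∧ insert i e ∈ C := by
  rw [X_mul_squarefreeMonomial, monomial_mem_circuitIdeal]
  simp only [Finsupp.add_apply, sum_single_one_apply, Finsupp.single_apply]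
  constructor
  · rintro ⟨G, hG, h⟩
    have hGe : G ⊆ insert i e := by
      intro k hk
      have := h k hk
      by_contra hk'
      rw [Finset.mem_insert, not_or] at hk'
      rw [if_neg (Ne.symm hk'.1), if_neg hk'.2] at this
      omega
    have hcard := hC G hG
    have hie : i ∉ e := fun hi => by
      rw [Finset.insert_eq_of_mem hi] at hGe
      have := Finset.card_le_card hGe
      omega
    refine ⟨hie, ?_⟩
    rwa [← Finset.eq_of_subset_of_card_le hGe (by rw [Finset.card_insert_of_notMem hie, hcard])]
  · rintro ⟨hi, h⟩
    refine ⟨_, h, fun k hk => ?_⟩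
    rcases Finset.mem_insert.mp hk with rfl | hk
    · simp
    · simp [hk]

theorem X_mul_squarefreeMonomial_eq_iff {i : Fin n} {e F : Finset (Fin n)}
    (hF : F.card = e.card + 1) :
    MvPolynomial.X i * squarefreeMonomial K e = squarefreeMonomial K F ↔
      i ∉ e ∧ insert i e = F := by
  constructor
  · intro h
    have h1 : MvPolynomial.X i * squarefreeMonomial K e ∈ circuitIdeal K {F} := by
      rw [h]; exact Ideal.subset_span ⟨F, by simp, rfl⟩
    rwa [X_mul_squarefreeMonomial_mem_circuitIdeal _ _ (by simpa using hF),
      Finset.mem_singleton] at h1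
  · rintro ⟨hi, rfl⟩
    unfold squarefreeMonomial
    rw [Finset.prod_insert hi]

theorem circuitIdeal_union (C D : Finset (Finset (Fin n))) :
    circuitIdeal K (C ∪ D) = circuitIdeal K C ⊔ circuitIdeal K D := by
  unfold circuitIdeal
  rw [← Ideal.span_union]
  congr 1
  ext f
  simp only [Finset.mem_union, or_and_right, exists_or]
  rfl

theorem idealDegrees_circuitIdeal_union {C A : Finset (Finset (Fin n))} {e X : Finset (Fin n)}
    (hX : ∀ F, F ∈ A ↔ ∃ i ∈ X, i ∉ e ∧ insert i e = F) :
    idealDegrees (circuitIdeal K (C ∪ A)) =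
      adjoinAbove (idealDegrees (circuitIdeal K C)) (squarefreeMultidegree e)
        (X.filter (· ∉ e)) := by
  ext c
  by_cases hc : 0 ≤ c
  · rw [mem_idealDegrees_circuitIdeal hc, adjoinAbove, Set.mem_union,
      mem_idealDegrees_circuitIdeal hc]
    simp only [Finset.mem_union, or_and_right, exists_or]
    refine or_congr_right ⟨?_, ?_⟩
    · rintro ⟨F, hF, h⟩
      obtain ⟨i, hiX, hie, rfl⟩ := (hX F).mp hF
      refine ⟨fun k => ?_, i, by simp [hiX, hie], ?_⟩
      · simp only [squarefreeMultidegree]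
        split_ifs with hk
        · exact h k (Finset.mem_insert_of_mem hk)
        · exact hc k
      · simpa [squarefreeMultidegree, hie] using h i (Finset.mem_insert_self i e)
    · rintro ⟨h, i, hi, hic⟩
      rw [Finset.mem_filter] at hi
      refine ⟨insert i e, (hX _).mpr ⟨i, hi.1, hi.2, rfl⟩, fun k hk => ?_⟩
      rcases Finset.mem_insert.mp hk with rfl | hk
      · simpa [squarefreeMultidegree, hi.2] using hic
      · simpa [squarefreeMultidegree, hk] using h k
  · refine ⟨fun h => absurd h.1 hc, ?_⟩
    rintro (h | h)
    · exact absurd h.1 hc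
    · refine absurd (le_trans (fun k => ?_) h.1) hc
      simp only [squarefreeMultidegree]; split_ifs <;> simp

theorem sum_squarefreeMultidegree (S : Finset (Fin n)) :
    ∑ k, squarefreeMultidegree S k = (S.card : ℤ) := by
  simp [squarefreeMultidegree]

theorem vecSupport_squarefreeMultidegree (S : Finset (Fin n)) :
    vecSupport (squarefreeMultidegree S) = S := by
  ext k; simp [vecSupport, squarefreeMultidegree]

theorem squarefreeMultidegree_vecSupport {b : Fin n → ℤ} (hb : ∀ k, b k = 0 ∨ b k = 1) :
    squarefreeMultidegree (vecSupport b) = b := by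
  funext k
  rcases hb k with h | h <;> simp [vecSupport, squarefreeMultidegree, h]

/-- For a simplicial maximal subcircuit `e`, the multidegrees above `e` of the circuit ideal of the
complement are those exceeding `e` at some vertex `i` with `e ∪ {i}` not a circuit. -/
theorem IsSimplicialMaximalSubcircuit.mem_idealDegrees_iff {d : ℕ} {C : Finset (Finset (Fin n))}
    {e : Finset (Fin n)} (he : IsSimplicialMaximalSubcircuit d C e) {c : Fin n → ℤ}
    (hc : squarefreeMultidegree e ≤ c) :
    c ∈ idealDegrees (circuitIdeal K (complementClutter d C)) ↔
      ∃ y, (y ∉ e ∧ insert y e ∈ complementClutter d C) ∧ squarefreeMultidegree e y + 1 ≤ c y := by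
  have hc0 : 0 ≤ c := le_trans (fun k => by
    simp only [squarefreeMultidegree]; split_ifs <;> simp) hc
  rw [mem_idealDegrees_circuitIdeal hc0]
  constructor
  · rintro ⟨G, hG, h⟩
    rw [complementClutter, Finset.mem_sdiff, Finset.mem_powersetCard_univ] at hG
    -- Simpliciality is used here: a non-circuit must leave the closed neighborhood, and a vertex
    -- `y` where it does so yields the non-circuit `e ∪ {y}`.
    have hsub : ¬ G ⊆ closedNeighborhood C e := fun hs => hG.2 (he.clique G hs hG.1)
    obtain ⟨y, hyG, hy⟩ := Finset.not_subset.mp hsub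
    rw [closedNeighborhood, Finset.mem_union, Finset.mem_filter, not_or] at hy
    refine ⟨y, ⟨hy.1, ?_⟩, ?_⟩
    · rw [complementClutter, Finset.mem_sdiff, Finset.mem_powersetCard_univ,
        Finset.card_insert_of_notMem hy.1]
      refine ⟨he.card_add_one, fun hmem => hy.2 ⟨Finset.mem_univ _, ?_⟩⟩
      rwa [Finset.union_comm, ← Finset.insert_eq]
    · simpa [squarefreeMultidegree, hy.1] using h y hyG
  · rintro ⟨y, ⟨hy, hmem⟩, hyc⟩
    refine ⟨_, hmem, fun k hk => ?_⟩
    rcases Finset.mem_insert.mp hk with rfl | hk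
    · simpa [squarefreeMultidegree, hy] using hyc
    · simpa [squarefreeMultidegree, hk] using hc k

theorem gradedBetti_add_of_multigradedBetti {I J : Ideal (MvPolynomial (Fin n) K)} {i : ℕ} {j : ℤ}
    {ι : Type*} (s : Finset ι) (f : ι → Fin n → ℤ) (hf : Function.Injective f)
    (hj : ∀ x ∈ s, ∑ k, f x k = j)
    (h : ∀ a, (a ∉ s.image f → multigradedBetti J i a = multigradedBetti I i a) ∧
      (a ∈ s.image f → multigradedBetti J i a = multigradedBetti I i a + 1)) :
    gradedBetti J i j = gradedBetti I i j + s.card := by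
  classical
  -- One finite set that carries both sums and all the exceptional multidegrees.
  set U : Finset (Fin n → ℤ) := ((finite_support_multigradedBetti I i).toFinset ∪
    (finite_support_multigradedBetti J i).toFinset ∪ s.image f).filter (fun a => ∑ k, a k = j)
    with hU
  have hsum : ∀ L : Ideal (MvPolynomial (Fin n) K),
      (Function.support (multigradedBetti L i)) ⊆ Function.support (multigradedBetti I i) ∪
        Function.support (multigradedBetti J i) →
      gradedBetti L i j = ∑ a ∈ U, multigradedBetti L i a := by
    intro L hL
    unfold gradedBetti
    refine finsum_mem_eq_sum_of_inter_support_eq _ ?_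
    ext a
    simp only [Set.mem_inter_iff, hU, Finset.coe_filter, Set.mem_ofPred_eq, Finset.mem_union,
      Set.Finite.mem_toFinset]
    constructor
    · rintro ⟨h1, h2⟩
      exact ⟨⟨Or.inl (hL h2), h1⟩, h2⟩
    · rintro ⟨⟨_, h1⟩, h2⟩
      exact ⟨h1, h2⟩
  rw [hsum I Set.subset_union_left, hsum J Set.subset_union_right]
  have h1 : ∀ a ∈ U, multigradedBetti J i a =
      multigradedBetti I i a + if a ∈ s.image f then 1 else 0 := by
    intro a _
    split_ifs with ha
    exacts [(h a).2 ha, (h a).1 ha]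
  rw [Finset.sum_congr rfl h1, Finset.sum_add_distrib, Finset.sum_boole, Nat.cast_id]
  congr 1
  rw [← Finset.card_image_of_injective s hf]
  congr 1
  ext a
  simp only [hU, Finset.mem_filter, Finset.mem_union]
  constructor
  · exact fun h => h.2
  · intro h
    refine ⟨⟨Or.inr h, ?_⟩, h⟩
    obtain ⟨x, hx, rfl⟩ := Finset.mem_image.mp h
    exact hj x hx

end Clutter

/-! ### The corollary -/

theorem corollary4p2 {n : ℕ} (K : Type*) [Field K] (d : ℕ) (C : Finset (Finset (Fin n)))
    (hC : IsUniformClutter d C) (e : Finset (Fin n)) (he : IsSimplicialMaximalSubcircuit d C e)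
    (A : Finset (Finset (Fin n))) (hA : A.Nonempty) (hAC : ∀ F ∈ A, F ∈ C ∧ e ⊂ F)
    (I J : Ideal (MvPolynomial (Fin n) K))
    (hI : I = circuitIdeal K (complementClutter d C))
    (hJ : J = circuitIdeal K (complementClutter d (C \ A)))
    (X Y : Finset (Fin n))
    (hX : ∀ i, i ∈ X ↔ ∃ F ∈ A, MvPolynomial.X i * squarefreeMonomial K e = squarefreeMonomial K F)
    (hY : ∀ i, i ∈ Y ↔ MvPolynomial.X i ∈ I.colon {squarefreeMonomial K e}) :
    J = I ⊔ circuitIdeal K A ∧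
    (∀ (i : ℕ) (a : Fin n → ℤ),
      multigradedBetti J i a = multigradedBetti I i a +
        if ∑ k, a k = (d : ℤ) + i ∧
            (∀ k, (a - squarefreeMultidegree e) k = 0 ∨ (a - squarefreeMultidegree e) k = 1) ∧
            vecSupport (a - squarefreeMultidegree e) ∈
              Finset.powersetCard (i + 1) (X ∪ Y) \ Finset.powersetCard (i + 1) Y
        then 1 else 0) ∧
    (∀ i : ℕ,
      (gradedBetti J i ((d : ℤ) + i) : ℤ) = (gradedBetti I i ((d : ℤ) + i) : ℤ) +
        ((X ∪ Y).card.choose (i + 1) : ℤ) - (Y.card.choose (i + 1) : ℤ)) := by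
  classical
  have hAcard : ∀ F ∈ A, F.card = e.card + 1 := fun F hF =>
    (hC.card_eq F (hAC F hF).1).trans he.card_add_one.symm
  have hcompl : complementClutter d (C \ A) = complementClutter d C ∪ A := by
    ext F
    simp only [complementClutter, Finset.mem_sdiff, Finset.mem_union,
      Finset.mem_powersetCard_univ]
    constructor
    · rintro ⟨h1, h2⟩
      by_cases hF : F ∈ A
      · exact Or.inr hF
      · exact Or.inl ⟨h1, fun h => h2 ⟨h, hF⟩⟩
    · rintro (⟨h1, h2⟩ | h)
      · exact ⟨h1, fun h => h2 h.1⟩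
      · exact ⟨hC.card_eq F (hAC F h).1, fun h' => h'.2 h⟩
  rw [hcompl] at hJ
  have hX' : ∀ i, i ∈ X ↔ i ∉ e ∧ insert i e ∈ A := by
    intro i
    rw [hX]
    constructor
    · rintro ⟨F, hF, h⟩
      obtain ⟨h1, rfl⟩ := (X_mul_squarefreeMonomial_eq_iff (hAcard F hF)).mp h
      exact ⟨h1, hF⟩
    · rintro ⟨h1, h2⟩
      exact ⟨_, h2, (X_mul_squarefreeMonomial_eq_iff (hAcard _ h2)).mpr ⟨h1, rfl⟩⟩
  have hY' : ∀ i, i ∈ Y ↔ i ∉ e ∧ insert i e ∈ complementClutter d C := by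
    intro i
    rw [hY, Submodule.mem_colon_singleton, smul_eq_mul, hI,
      X_mul_squarefreeMonomial_mem_circuitIdeal]
    intro F hF
    rw [complementClutter, Finset.mem_sdiff, Finset.mem_powersetCard_univ] at hF
    rw [hF.1, he.card_add_one]
  have hXY : Disjoint X Y := by
    rw [Finset.disjoint_left]
    intro i hiX hiY
    have h1 := (hAC _ ((hX' i).mp hiX).2).1
    have h2 := ((hY' i).mp hiY).2
    rw [complementClutter, Finset.mem_sdiff] at h2
    exact h2.2 h1
  -- Every `F ∈ A` exceeds `e` by exactly one vertex, so `X` parametrizes `A`.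
  have hAX : ∀ F, F ∈ A ↔ ∃ i ∈ X, i ∉ e ∧ insert i e = F := by
    intro F
    constructor
    · intro hF
      obtain ⟨i, hi⟩ : ∃ i, F \ e = {i} := by
        rw [← Finset.card_eq_one, Finset.card_sdiff_of_subset (hAC F hF).2.subset, hAcard F hF]
        omega
      have hins : insert i e = F := by
        rw [Finset.insert_eq, ← hi, Finset.sdiff_union_of_subset (hAC F hF).2.subset]
      have hie : i ∉ e := by
        have : i ∈ F \ e := hi ▸ Finset.mem_singleton_self i
        exact (Finset.mem_sdiff.mp this).2
      exact ⟨i, (hX' i).mpr ⟨hie, hins ▸ hF⟩, hie, hins⟩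
    · rintro ⟨i, hiX, -, rfl⟩
      exact ((hX' i).mp hiX).2
  have hXe : X.filter (· ∉ e) = X := Finset.filter_true_of_mem fun i hi => ((hX' i).mp hi).1
  have hdeg : idealDegrees J = adjoinAbove (idealDegrees I) (squarefreeMultidegree e) X := by
    rw [hJ, hI, idealDegrees_circuitIdeal_union hAX, hXe]
  -- This is the linearity of `I : x_e` in terms of multidegrees, supplied by simpliciality of `e`.
  have hYdeg : ∀ c, squarefreeMultidegree e ≤ c →
      (c ∈ idealDegrees I ↔ ∃ y ∈ Y, squarefreeMultidegree e y + 1 ≤ c y) := by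
    intro c hc
    rw [hI, he.mem_idealDegrees_iff hc]
    simp only [hY']
  have hbetti : ∀ (i : ℕ) (a : Fin n → ℤ), multigradedBetti J i a = multigradedBetti I i a +
      if ∃ S ⊆ X ∪ Y, S.card = i + 1 ∧ ¬ S ⊆ Y ∧
        a = squarefreeMultidegree e + squarefreeMultidegree S then 1 else 0 := by
    intro i a
    have hmI : IsMonomialIdeal I := hI ▸ isMonomialIdeal_circuitIdeal K _
    have hmJ : IsMonomialIdeal J := hJ ▸ isMonomialIdeal_circuitIdeal K _
    rw [hmJ.multigradedBetti_eq, hmI.multigradedBetti_eq, hdeg,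
      koszulBetti_adjoinAbove (isUpperSet_idealDegrees I) _ X Y hXY hYdeg]
    simp
  have hecard : (e.card : ℤ) + 1 = d := by exact_mod_cast he.card_add_one
  refine ⟨?_, fun i a => ?_, fun i => ?_⟩
  · rw [hJ, hI, circuitIdeal_union]
  · rw [hbetti]
    congr 1
    refine if_congr ⟨?_, ?_⟩ rfl rfl
    · rintro ⟨S, hS, hcard, hSY, rfl⟩
      rw [add_sub_cancel_left, vecSupport_squarefreeMultidegree]
      refine ⟨?_, fun k => ?_, ?_⟩
      · simp only [Pi.add_apply, Finset.sum_add_distrib, sum_squarefreeMultidegree, hcard]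
        push_cast
        omega
      · simp only [squarefreeMultidegree]; split_ifs <;> simp
      · simp [Finset.mem_powersetCard, hS, hcard, hSY]
    · rintro ⟨-, h2, h3⟩
      simp only [Finset.mem_sdiff, Finset.mem_powersetCard, not_and] at h3
      refine ⟨_, h3.1.1, h3.1.2, fun h => h3.2 h h3.1.2, ?_⟩
      rw [squarefreeMultidegree_vecSupport h2, add_sub_cancel]
  · have h := gradedBetti_add_of_multigradedBetti (I := I) (J := J) (i := i) (j := (d : ℤ) + i)
      (Finset.powersetCard (i + 1) (X ∪ Y) \ Finset.powersetCard (i + 1) Y)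
      (fun S => squarefreeMultidegree e + squarefreeMultidegree S)
      (fun S T h => squarefreeMultidegree_injective (add_left_cancel h)) ?_ ?_
    · rw [Finset.card_sdiff_of_subset (Finset.powersetCard_mono Finset.subset_union_right),
        Finset.card_powersetCard, Finset.card_powersetCard] at h
      -- Needed to turn the truncated difference of binomials into the integer difference.
      have hle := Nat.choose_le_choose (i + 1) (Finset.card_le_card
        (Finset.subset_union_right : Y ⊆ X ∪ Y))
      rw [h]
      push_cast [Nat.cast_sub hle]
      ring
    · intro S hS
      rw [Finset.mem_sdiff, Finset.mem_powersetCard] at hS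
      simp only [Pi.add_apply, Finset.sum_add_distrib, sum_squarefreeMultidegree, hS.1.2]
      push_cast
      omega
    · intro a
      have hiff : (∃ S ⊆ X ∪ Y, S.card = i + 1 ∧ ¬ S ⊆ Y ∧
          a = squarefreeMultidegree e + squarefreeMultidegree S) ↔
          a ∈ (Finset.powersetCard (i + 1) (X ∪ Y) \ Finset.powersetCard (i + 1) Y).image
            (fun S => squarefreeMultidegree e + squarefreeMultidegree S) := by
        simp only [Finset.mem_image, Finset.mem_sdiff, Finset.mem_powersetCard, not_and]
        refine exists_congr fun S => ?_
        constructor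
        · rintro ⟨h1, h2, h3, h4⟩
          exact ⟨⟨⟨h1, h2⟩, fun h => absurd h h3⟩, h4.symm⟩
        · rintro ⟨⟨⟨h1, h2⟩, h3⟩, h4⟩
          exact ⟨h1, h2, fun h => h3 h h2, h4.symm⟩
      rw [hbetti, ← hiff]
      exact ⟨fun h => by rw [if_neg h, add_zero], fun h => by rw [if_pos h]⟩
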